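/- Let $d\ge 2$ and let $\mathcal T_h$ be a finite conforming simplicial triangulation of a bounded polyhedral domain $\Omega\subset\mathbb R^d$ (with $\Omega=\operatorname{int}\overline\Omega$, e.g. a Lipschitz domain). Let $\mathcal E$ be its set of facets, let $\mathcal E_N$ be a set of boundary facets (the Neumann facets), and let $h_F$ be the diameter of $F\in\mathcal E$. For each $F\in\mathcal E$ let $\mathbf n_F$ be a unit normal to $F$, pointing out of $\Omega$ if $F$ is a boundary facet. On an interior facet let $[[w]]|_F$ be the trace of $w$ from the element whose outward normal on $F$ is $\mathbf n_F$, minus the trace from the other element; on a boundary facet let $[[w]]|_F$ be the trace of $w$. Let $A$ be a symmetric positive definite tensor that is constant on each element, and let $A_F>0$ be the minimum, over the one or two elements $K$ containing $F$, of the largest eigenvalue of $A|_K$. For an integer $s\ge 0$ let $DG(\mathcal T_h,s)=\{v\in L^2(\Omega): v|_K\in\mathbb P_s(K)\ \forall K\in\mathcal T_h\}$, let $RT(\mathcal T_h,s)=\{\boldsymbol\tau\in H(\mathrm{div};\Omega): \boldsymbol\tau|_K\in\mathbb P_s(K)^d+\boldsymbol x\,\mathbb P_s(K)\ \forall K\in\mathcal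 T_h\}$, and let $$\mathring{RT}(\mathcal T_h,s)=\{\boldsymbol\tau\in RT(\mathcal T_h,s): (\boldsymbol\tau,\boldsymbol\psi)_K=0\ \ \forall\boldsymbol\psi\in\mathbb P_{s-1}(K)^d,\ K\in\mathcal T_h;\quad \boldsymbol\tau\cdot\mathbf n_F=0\ \ \forall F\in\mathcal E_N\},$$ where the first condition is void for $s=0$. Let $\mathring{RT}^0(\mathcal T_h,s)=\{\boldsymbol\tau\in\mathring{RT}(\mathcal T_h,s):\nabla\cdot\boldsymbol\tau=0\}$. Then the following hold. 1. The symmetric bilinear form $$\langle\boldsymbol\sigma,\boldsymbol\tau\rangle=\sum_{F\in\mathcal E\setminus\mathcal E_N}h_F A_F^{-1}\int_F(\boldsymbol\sigma\cdot\mathbf n_F)(\boldsymbol\tau\cdot\mathbf n_F)\,ds$$ is positive definite on $\mathring{RT}(\mathcal T_h,s)$, hence an inner product there. 2. For every $w\in DG(\mathcal T_h,s)$ there is exactly one $\mathbf S(w)\in\mathring{RT}(\mathcal T_h,s)$ with $$\mathbf S(w)\cdot\mathbf n_F|_F=A_F h_F^{-1}[[w]]|_F\qquad\forall F\in\mathcal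 E\setminus\mathcal E_N .$$ 3. $\{\mathbf S(w): w\in DG(\mathcal T_h,s)\}\subset\mathring{RT}^0(\mathcal T_h,s)^\perp$, where $\perp$ denotes the orthogonal complement in $\mathring{RT}(\mathcal T_h,s)$ with respect to $\langle\cdot,\cdot\rangle$. -/

import Mathlib

open MeasureTheory
open scoped ContDiff

noncomputable section

namespace EARM

/-- The ambient Euclidean space `ℝᵈ`. -/
abbrev Space (d : ℕ) : Type := EuclideanSpace ℝ (Fin d)

/-- Real polynomials in the `d` coordinates. -/
abbrev Poly (d : ℕ) : Type := MvPolynomial (Fin d) ℝ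

/-- Polynomial vector fields on `ℝᵈ`, given by their components. -/
abbrev PolyField (d : ℕ) : Type := Fin d → Poly d

/-- The value of a polynomial at a point. -/
def Poly.val {d : ℕ} (p : Poly d) (x : Space d) : ℝ :=
  MvPolynomial.eval (fun i => x i) p

/-- The value of a polynomial vector field at a point. -/
def PolyField.val {d : ℕ} (q : PolyField d) (x : Space d) : Space d :=
  WithLp.toLp 2 (fun i => Poly.val (q i) x)

/-- A finite conforming simplicial triangulation of (the closure of) `Ω ⊆ ℝᵈ`: a finite simplicial
complex, all of whose faces are faces of `d`-simplices and whose underlying space is the closure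
of `Ω`. A simplex is represented by the finite set of its vertices. -/
structure Triangulation (d : ℕ) (Ω : Set (Space d)) extends
    Geometry.SimplicialComplex ℝ (Space d) where
  finite_faces : faces.Finite
  pure : ∀ s ∈ faces, ∃ K ∈ faces, K.card = d + 1 ∧ s ⊆ K
  space_eq : toSimplicialComplex.space = closure Ω

/-- The (closed) simplex spanned by a finite set of vertices. -/
def hull {d : ℕ} (K : Finset (Space d)) : Set (Space d) :=
  convexHull ℝ (K : Set (Space d))

/-- `ν` is a unit normal to the facet with vertex set `F`. -/
def IsUnitNormal {d : ℕ} (F : Finset (Space d)) (ν : Space d) : Prop :=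
  ‖ν‖ = 1 ∧ ∀ x ∈ F, ∀ y ∈ F, inner ℝ ν (x - y) = 0

/-- `ν` is the unit normal to the facet `F` of the simplex `K` that points out of `K`. -/
def IsOutwardNormal {d : ℕ} (K F : Finset (Space d)) (ν : Space d) : Prop :=
  IsUnitNormal F ν ∧ ∀ p ∈ K, p ∉ F → ∀ x ∈ F, inner ℝ ν (p - x) < 0

open Classical in
/-- The sign of `K` on its facet `F`, for the unit normal `ν` chosen on `F`: it is `1` if `ν` is
the outward normal of `K` and `-1` otherwise. -/
def signOf {d : ℕ} (K F : Finset (Space d)) (ν : Space d) : ℝ :=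
  if IsOutwardNormal K F ν then 1 else -1

/-- `g` is the weak (distributional) divergence of the vector field `τ` in `Ω`. -/
def HasWeakDivergence {d : ℕ} (Ω : Set (Space d)) (τ : Space d → Space d) (g : Space d → ℝ) :
    Prop :=
  ∀ φ : Space d → ℝ, ContDiff ℝ ∞ φ → HasCompactSupport φ → tsupport φ ⊆ Ω →
    ∫ x in Ω, fderiv ℝ φ x (τ x) = - ∫ x in Ω, g x * φ x

/-- The space `H(div; Ω)`. -/
def MemHDiv {d : ℕ} (Ω : Set (Space d)) (τ : Space d → Space d) : Prop :=
  MemLp τ 2 (volume.restrict Ω) ∧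
    ∃ g : Space d → ℝ, MemLp g 2 (volume.restrict Ω) ∧ HasWeakDivergence Ω τ g

/-- The local Raviart-Thomas space `RT(K, s) = P_s ^ d + x P_s`. -/
def localRT (d s : ℕ) : Set (PolyField d) :=
  {q | ∃ a : PolyField d, (∀ i, (a i).totalDegree ≤ s) ∧
    ∃ b : Poly d, b.totalDegree ≤ s ∧ ∀ i, q i = a i + MvPolynomial.X i * b}

/-- The maximal eigenvalue of a (symmetric) real matrix. -/
def maxEigenvalue {d : ℕ} (M : Matrix (Fin d) (Fin d) ℝ) : ℝ :=
  sSup (spectrum ℝ M)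

namespace Triangulation

variable {d : ℕ} {Ω : Set (Space d)} (T : Triangulation d Ω)

open Classical in
/-- The elements (the `d`-simplices). -/
def elements : Finset (Finset (Space d)) :=
  T.finite_faces.toFinset.filter (fun K => K.card = d + 1)

open Classical in
/-- The facets, i.e. the `(d - 1)`-dimensional faces of the elements. -/
def facets : Finset (Finset (Space d)) :=
  T.elements.biUnion (fun K => K.powersetCard d)

open Classical in
/-- The elements that have `F` as a facet. -/
def elementsAt (F : Finset (Space d)) : Finset T.elements :=
  Finset.univ.filter (fun K => F ⊆ K.1)

open Classical in
/-- The boundary facets: those that belong to exactly one element. -/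
def boundaryFacets : Finset (Finset (Space d)) :=
  T.facets.filter (fun F => (T.elementsAt F).card = 1)

open Classical in
/-- The facets outside a given set `EN` of (Neumann) facets. -/
def facetsOutside (EN : Finset (Finset (Space d))) : Finset (Finset (Space d)) :=
  T.facets.filter (fun F => F ∉ EN)

/-- `n` assigns a unit normal to each facet: an arbitrary one on interior facets, and the outward
one on boundary facets. -/
def IsNormalField (n : Finset (Space d) → Space d) : Prop :=
  (∀ F ∈ T.facets, IsUnitNormal F (n F)) ∧
    ∀ F ∈ T.boundaryFacets, ∀ K ∈ T.elementsAt F, IsOutwardNormal K.1 F (n F)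

/-- Discontinuous piecewise polynomials of degree at most `s`, given by the tuple of
their restrictions to the elements. -/
def DG (s : ℕ) : Set (T.elements → Poly d) :=
  {v | ∀ K, (v K).totalDegree ≤ s}

/-- The jump of `v` on the facet `F`, at the point `x`. On an interior facet this is the trace from
the element with outward normal `n F` minus the trace from the other one; on a boundary
facet it is the trace from the only adjacent element. -/
def jump (n : Finset (Space d) → Space d) (v : T.elements → Poly d) (F : Finset (Space d))
    (x : Space d) : ℝ :=
  ∑ K ∈ T.elementsAt F, signOf K.1 F (n F) * (v K).val x

/-- The vector field on `ℝᵈ` with the given restrictions to the (interiors of the) elements; it is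
zero on the rest, which within `Ω` has measure zero. -/
def toField (τ : T.elements → PolyField d) (x : Space d) : Space d :=
  ∑ K : T.elements, (interior (hull K.1)).indicator (τ K).val x

/-- The Raviart-Thomas space `RT(T, s)`. -/
def RT (s : ℕ) : Set (T.elements → PolyField d) :=
  {τ | (∀ K, τ K ∈ localRT d s) ∧ MemHDiv Ω (T.toField τ)}

/-- The space of those `τ ∈ RT(T, s)` that are orthogonal to `P_{s-1} ^ d` on every element (no
condition if `s = 0`) and whose normal component vanishes on the facets in `EN`. -/
def RTring (EN : Finset (Finset (Space d))) (n : Finset (Space d) → Space d) (s : ℕ) :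
    Set (T.elements → PolyField d) :=
  {τ | τ ∈ T.RT s ∧
    (∀ (K : T.elements) (ψ : PolyField d), (∀ i, (ψ i).totalDegree < s) →
      ∫ x in hull K.1, inner ℝ ((τ K).val x) (ψ.val x) = 0) ∧
    ∀ F ∈ EN, ∀ K ∈ T.elementsAt F, ∀ x ∈ hull F, inner ℝ ((τ K).val x) (n F) = 0}

/-- The divergence-free subspace of `RTring`. -/
def RTringDivFree (EN : Finset (Finset (Space d))) (n : Finset (Space d) → Space d) (s : ℕ) :
    Set (T.elements → PolyField d) :=
  {τ | τ ∈ T.RTring EN n s ∧ HasWeakDivergence Ω (T.toField τ) 0}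

/-- The normal component `τ · n_F` on the facet `F`, at the point `x`. For `τ ∈ RT(T, s)` the traces
from the adjacent elements agree, so that their mean is the common value. -/
def normalTrace (n : Finset (Space d) → Space d) (τ : T.elements → PolyField d)
    (F : Finset (Space d)) (x : Space d) : ℝ :=
  ((T.elementsAt F).card : ℝ)⁻¹ * ∑ K ∈ T.elementsAt F, inner ℝ ((τ K).val x) (n F)

/-- The coefficient `A_F`: the minimum, over the one or two elements `K` adjacent to `F`, of the
maximal eigenvalue of the diffusion tensor on `K`. -/
def facetCoeff (A : T.elements → Matrix (Fin d) (Fin d) ℝ) (F : Finset (Space d)) : ℝ :=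
  ⨅ K : T.elementsAt F, maxEigenvalue (A K.1)

/-- The size `h_F` of a facet. -/
def facetSize (F : Finset (Space d)) : ℝ :=
  Metric.diam (hull F)

/-- The facet inner product `∑ h_F A_F⁻¹ ∫_F (σ · n_F) (τ · n_F) ds`, the sum being over the facets
outside `EN`, with the `(d - 1)`-dimensional surface measure on each facet. -/
def facetInner (A : T.elements → Matrix (Fin d) (Fin d) ℝ) (EN : Finset (Finset (Space d)))
    (n : Finset (Space d) → Space d) (σ τ : T.elements → PolyField d) : ℝ :=
  ∑ F ∈ T.facetsOutside EN, facetSize F * (T.facetCoeff A F)⁻¹ *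
    ∫ x in hull F, T.normalTrace n σ F x * T.normalTrace n τ F x
      ∂(Measure.euclideanHausdorffMeasure (d - 1))

/-- The orthogonal complement of the divergence-free subspace in `RTring`, for the facet inner
product. -/
def RTringDivFreePerp (A : T.elements → Matrix (Fin d) (Fin d) ℝ)
    (EN : Finset (Finset (Space d))) (n : Finset (Space d) → Space d) (s : ℕ) :
    Set (T.elements → PolyField d) :=
  {σ | σ ∈ T.RTring EN n s ∧ ∀ τ ∈ T.RTringDivFree EN n s, T.facetInner A EN n σ τ = 0}

end Triangulation

end EARM

end

/-! Everything rests on the unisolvence of the local space `P_s ^ d + x P_s` on a simplex: its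
normal traces in `P_s` on the facets can be prescribed freely, together with zero moments against
`P_{s-1} ^ d`, and these data determine the field.

Uniqueness (`localRT_eq_zero`). Let `q` have zero traces and moments. Testing the divergence theorem
with `div q`, whose gradient lies in `P_{s-1} ^ d`, gives `∫ (div q)² = 0`. Euler's identity then
removes the top-degree part of the `x P_s` term, so `q ∈ P_s ^ d`. Hence `q · ∇λ_p`, which vanishes
on the facet opposite to `p`, equals `λ_p r_p` with `r_p ∈ P_{s-1}`. The moment against `∑ r_p ∇λ_p`
is `∫ ∑ λ_p r_p²`, so every `r_p` is zero, and `q = ∑ (∇λ_p · q) p = 0`.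

Existence (`exists_localRT`). The field `∑ c_p g_p (p - x)`, with suitable constants `c_p`, has the
traces `g_p`. Its moments are removed by a bubble `∑ λ_p (p - x) ((p - x) · ψ)`, which has no normal
trace and whose pairing with `ψ` is positive definite. No dimension of the Raviart-Thomas space is
needed.

The global step is that a piecewise polynomial field lies in `H(div; Ω)` exactly when its normal
jumps vanish on interior facets (`memHDiv_of_normalJump_eq_zero`, `normalJump_eq_zero_of_memHDiv`).
Conformity puts exactly two elements, on opposite sides, at each interior facet; `Ω = int (closure
Ω)` keeps boundary facets out of `Ω` and the relative interiors of interior facets in it.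

Now a field in the constrained space with `⟨σ, σ⟩ = 0` has no normal traces, hence is zero. Solving
the local problems with the scaled jumps as data gives `S(w)`: two neighbours use the same datum, so
the pieces match. Finally, for divergence-free `τ`, elementwise integration by parts against `w`
leaves only `∑_F ∫_F [[w]] τ · n_F = 0`: the volume terms vanish by `div τ = 0` and the moment
condition. The weights in `S(w)` and in the form cancel, so this sum is `⟨S(w), τ⟩`. -/

noncomputable section

namespace EARM

variable {d : ℕ}

/-! ### Polynomials and their values -/

namespace Poly

@[simp] lemma val_zero (x : Space d) : Poly.val (0 : Poly d) x = 0 := by simp [Poly.val]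

@[simp] lemma val_one (x : Space d) : Poly.val (1 : Poly d) x = 1 := by simp [Poly.val]

@[simp] lemma val_C (c : ℝ) (x : Space d) : Poly.val (MvPolynomial.C c : Poly d) x = c := by
  simp [Poly.val]

@[simp] lemma val_X (i : Fin d) (x : Space d) : Poly.val (MvPolynomial.X i : Poly d) x = x i := by
  simp [Poly.val]

@[simp] lemma val_add (p q : Poly d) (x : Space d) : (p + q).val x = p.val x + q.val x := by
  simp [Poly.val]

@[simp] lemma val_sub (p q : Poly d) (x : Space d) : (p - q).val x = p.val x - q.val x := by
  simp [Poly.val]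

@[simp] lemma val_mul (p q : Poly d) (x : Space d) : (p * q).val x = p.val x * q.val x := by
  simp [Poly.val]

@[simp] lemma val_sum {ι : Type*} (s : Finset ι) (p : ι → Poly d) (x : Space d) :
    (∑ i ∈ s, p i).val x = ∑ i ∈ s, (p i).val x := by
  simp [Poly.val]

lemma hasFDerivAt_val (p : Poly d) (x : Space d) :
    HasFDerivAt p.val
      (∑ i, Poly.val (MvPolynomial.pderiv i p) x • (EuclideanSpace.proj i : Space d →L[ℝ] ℝ)) x := by
  induction p using MvPolynomial.induction_on with
  | C a =>
    have h : (Poly.val (MvPolynomial.C a : Poly d)) = fun _ => a := by ext; simp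
    rw [h]
    simpa using hasFDerivAt_const a x
  | add p q hp hq =>
    have h : Poly.val (p + q) = fun y => Poly.val p y + Poly.val q y := by ext; simp
    rw [h]
    refine (hp.add hq).congr_fderiv (ContinuousLinearMap.ext fun v => ?_)
    simp [add_mul, Finset.sum_add_distrib]
  | mul_X p j hp =>
    have h : Poly.val (p * MvPolynomial.X j) = fun y => Poly.val p y * y j := by ext; simp
    rw [h]
    have hX : HasFDerivAt (fun y : Space d => y j)
        (EuclideanSpace.proj j : Space d →L[ℝ] ℝ) x :=
      (EuclideanSpace.proj j : Space d →L[ℝ] ℝ).hasFDerivAt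
    refine (hp.mul hX).congr_fderiv (ContinuousLinearMap.ext fun v => ?_)
    have h1 : ∀ i, Poly.val (MvPolynomial.pderiv i (MvPolynomial.X j)) x * v i =
        if i = j then v j else 0 := by
      intro i
      rw [MvPolynomial.pderiv_X]
      split_ifs with hij
      · subst hij; simp
      · simp [Ne.symm hij]
    simp [Derivation.leibniz, add_mul, Finset.sum_add_distrib, Finset.mul_sum, mul_assoc,
      -MvPolynomial.pderiv_X, h1]

lemma fderiv_val (p : Poly d) (x v : Space d) :
    fderiv ℝ p.val x v = ∑ i, Poly.val (MvPolynomial.pderiv i p) x * v i := by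
  rw [(hasFDerivAt_val p x).fderiv]
  simp

lemma contDiff_val (p : Poly d) {n : WithTop ℕ∞} : ContDiff ℝ n p.val := by
  induction p using MvPolynomial.induction_on with
  | C a =>
    have h : (Poly.val (MvPolynomial.C a : Poly d)) = fun _ => a := by ext; simp
    rw [h]; exact contDiff_const
  | add p q hp hq =>
    have h : Poly.val (p + q) = fun y => Poly.val p y + Poly.val q y := by ext; simp
    rw [h]; exact hp.add hq
  | mul_X p j hp =>
    have h : Poly.val (p * MvPolynomial.X j) = fun y => Poly.val p y * y j := by ext; simp
    rw [h]; exact hp.mul (EuclideanSpace.proj j : Space d →L[ℝ] ℝ).contDiff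

lemma continuous_val (p : Poly d) : Continuous p.val := (contDiff_val p (n := 0)).continuous

/-- A polynomial that vanishes on a set with nonempty interior is zero. -/
lemma eq_zero_of_val_eq_zero {p : Poly d} {S : Set (Space d)} (hS : (interior S).Nonempty)
    (h : ∀ x ∈ S, p.val x = 0) : p = 0 := by
  obtain ⟨x, hx⟩ := hS
  have h1 : (WithLp.toLp 2 : (Fin d → ℝ) → Space d) ⁻¹' S ∈ nhds (WithLp.ofLp x) :=
    (PiLp.continuous_toLp 2 (fun _ : Fin d => ℝ)).continuousAt.preimage_mem_nhds
      (mem_interior_iff_mem_nhds.1 hx)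
  obtain ⟨ε, hε, hb⟩ := Metric.mem_nhds_iff.1 h1
  refine MvPolynomial.funext_set (fun i => Metric.ball (x i) ε) (fun i => ?_) fun y hy => ?_
  · rw [Real.ball_eq_Ioo]
    exact Set.Ioo_infinite (by linarith)
  · rw [map_zero]
    refine h (WithLp.toLp 2 y) (hb ?_)
    rw [← ball_pi _ hε] at hy
    exact hy

lemma eq_of_val_eq {p q : Poly d} {S : Set (Space d)} (hS : (interior S).Nonempty)
    (h : ∀ x ∈ S, p.val x = q.val x) : p = q :=
  sub_eq_zero.1 (eq_zero_of_val_eq_zero hS fun x hx => by simp [h x hx])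

/-- The polynomial of degree at most one whose values are `c + ⟪g, x⟫`. -/
def affine (c : ℝ) (g : Space d) : Poly d :=
  MvPolynomial.C c + ∑ i, MvPolynomial.C (g i) * MvPolynomial.X i

@[simp] lemma val_affine (c : ℝ) (g x : Space d) : (affine c g).val x = c + inner ℝ g x := by
  simp [affine, PiLp.inner_apply, mul_comm]

lemma totalDegree_affine (c : ℝ) (g : Space d) : (affine c g).totalDegree ≤ 1 := by
  refine (MvPolynomial.totalDegree_add _ _).trans (max_le (by simp) ?_)
  refine (MvPolynomial.totalDegree_finsetSum _ _).trans (Finset.sup_le fun i _ => ?_)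
  refine (MvPolynomial.totalDegree_mul _ _).trans ?_
  simp

end Poly

namespace PolyField

@[simp] lemma val_apply (q : PolyField d) (x : Space d) (i : Fin d) :
    q.val x i = (q i).val x := rfl

lemma continuous_val (q : PolyField d) : Continuous q.val :=
  (PiLp.continuous_toLp 2 (fun _ : Fin d => ℝ)).comp
    (continuous_pi fun i => Poly.continuous_val (q i))

@[simp] lemma val_add (p q : PolyField d) (x : Space d) :
    PolyField.val (p + q) x = p.val x + q.val x := by ext i; simp

@[simp] lemma val_sub (p q : PolyField d) (x : Space d) :
    PolyField.val (p - q) x = p.val x - q.val x := by ext i; simp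

/-- The divergence of a polynomial vector field. -/
def div (q : PolyField d) : Poly d := ∑ i, MvPolynomial.pderiv i (q i)

/-- The scalar product of a polynomial vector field with a constant vector. -/
def dot (q : PolyField d) (v : Space d) : Poly d := ∑ i, q i * MvPolynomial.C (v i)

@[simp] lemma val_dot (q : PolyField d) (v x : Space d) :
    (q.dot v).val x = inner ℝ (q.val x) v := by
  simp [dot, PiLp.inner_apply, mul_comm]

lemma totalDegree_dot_le {q : PolyField d} {s : ℕ} (h : ∀ i, (q i).totalDegree ≤ s)
    (v : Space d) : (q.dot v).totalDegree ≤ s := by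
  refine (MvPolynomial.totalDegree_finsetSum _ _).trans (Finset.sup_le fun i _ => ?_)
  exact (MvPolynomial.totalDegree_mul _ _).trans (by simpa using h i)

end PolyField

lemma totalDegree_pderiv_le (i : Fin d) (p : Poly d) :
    (MvPolynomial.pderiv i p).totalDegree ≤ p.totalDegree - 1 := by
  conv_lhs => rw [p.as_sum]
  rw [map_sum]
  refine (MvPolynomial.totalDegree_finsetSum _ _).trans (Finset.sup_le fun m hm => ?_)
  rw [MvPolynomial.pderiv_monomial]
  by_cases h0 : m i = 0
  · simp [h0]
  · refine (MvPolynomial.totalDegree_monomial_le _ _).trans ?_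
    have h1 := MvPolynomial.le_totalDegree hm
    have h2 : m = (m - Finsupp.single i 1) + Finsupp.single i 1 := by
      ext j
      by_cases hj : i = j
      · subst hj; simp; omega
      · simp [hj]
    have h3 : Finsupp.degree m = Finsupp.degree (m - Finsupp.single i 1) + 1 := by
      conv_lhs => rw [h2]
      simp
    have h4 : (m.sum fun _ e => e) = Finsupp.degree m := rfl
    rw [h4] at h1
    change Finsupp.degree (m - Finsupp.single i 1) ≤ _
    omega

/-- Strictness fails for `s = 0`, because the zero polynomial has total degree `0`; constants are
treated separately throughout. -/
lemma totalDegree_pderiv_lt {i : Fin d} {p : Poly d} {s : ℕ} (hs : s ≠ 0)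
    (hp : p.totalDegree ≤ s) : (MvPolynomial.pderiv i p).totalDegree < s := by
  have := totalDegree_pderiv_le i p
  omega

lemma pderiv_eq_zero_of_totalDegree_eq_zero {i : Fin d} {p : Poly d} (hp : p.totalDegree = 0) :
    MvPolynomial.pderiv i p = 0 := by
  rw [MvPolynomial.totalDegree_eq_zero_iff_eq_C.1 hp, MvPolynomial.pderiv_C]

/-- In the divergence of `a + x b` the part `a ∈ P_s ^ d` does not reach degree `s`, so the top
degree sees `b` alone. -/
lemma homogeneousComponent_pderiv_eq_zero {i : Fin d} {p : Poly d} {s : ℕ}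
    (hp : p.totalDegree ≤ s) :
    MvPolynomial.homogeneousComponent s (MvPolynomial.pderiv i p) = 0 := by
  rcases eq_or_ne s 0 with rfl | hs
  · rw [pderiv_eq_zero_of_totalDegree_eq_zero (Nat.le_zero.1 hp), map_zero]
  · exact MvPolynomial.homogeneousComponent_eq_zero _ _ (totalDegree_pderiv_lt hs hp)

lemma totalDegree_lt_of_homogeneousComponent_eq_zero {p : Poly d} {s : ℕ} (hs : s ≠ 0)
    (hp : p.totalDegree ≤ s) (h : MvPolynomial.homogeneousComponent s p = 0) :
    p.totalDegree < s := by
  refine lt_of_le_of_ne hp fun he => ?_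
  have hp0 : p ≠ 0 := by rintro rfl; simp at he; omega
  obtain ⟨m, hm, hmd⟩ := Finset.exists_mem_eq_sup p.support
    (MvPolynomial.support_nonempty.2 hp0) (fun m => m.sum fun _ e => e)
  have h1 : MvPolynomial.coeff m (MvPolynomial.homogeneousComponent s p) = 0 := by rw [h]; simp
  rw [MvPolynomial.coeff_homogeneousComponent, if_pos] at h1
  · exact (MvPolynomial.mem_support_iff.1 hm) h1
  · change (m.sum fun _ e => e) = s
    rw [← hmd]; exact he

/-- Euler's identity for the top-degree part of `x b`. -/
lemma homogeneousComponent_div_X_mul (b : Poly d) (s : ℕ) :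
    MvPolynomial.homogeneousComponent s
        (∑ i, MvPolynomial.pderiv i (MvPolynomial.X i * b) : Poly d) =
      ((d + s : ℕ) : ℝ) • MvPolynomial.homogeneousComponent s b := by
  have h1 : (∑ i, MvPolynomial.pderiv i (MvPolynomial.X i * b) : Poly d) =
      (d : ℝ) • b + ∑ i, MvPolynomial.X i * MvPolynomial.pderiv i b := by
    simp [Derivation.leibniz, Finset.sum_add_distrib, MvPolynomial.smul_eq_C_mul]
    ring
  have h2 : ∀ k, (∑ i, MvPolynomial.X i *
      MvPolynomial.pderiv i (MvPolynomial.homogeneousComponent k b) : Poly d) =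
      (k : ℝ) • MvPolynomial.homogeneousComponent k b := by
    intro k
    rw [(MvPolynomial.homogeneousComponent_isHomogeneous k b).sum_X_mul_pderiv]
    simp [Nat.cast_smul_eq_nsmul]
  have h3 : (∑ i, MvPolynomial.X i * MvPolynomial.pderiv i b : Poly d) =
      ∑ k ∈ Finset.range (b.totalDegree + 1), (k : ℝ) • MvPolynomial.homogeneousComponent k b := by
    conv_lhs => rw [← MvPolynomial.sum_homogeneousComponent b]
    simp_rw [map_sum, Finset.mul_sum]
    rw [Finset.sum_comm]
    exact Finset.sum_congr rfl fun k _ => h2 k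
  rw [h1, h3, map_add, map_smul, map_sum, Nat.cast_add, add_smul]
  congr 1
  simp_rw [map_smul]
  have h4 : ∀ k, MvPolynomial.homogeneousComponent s (MvPolynomial.homogeneousComponent k b) =
      if k = s then MvPolynomial.homogeneousComponent s b else 0 := by
    intro k
    rw [MvPolynomial.homogeneousComponent_of_mem
      (MvPolynomial.homogeneousComponent_mem k b)]
    split_ifs with h5 h6 h6
    · rw [h6]
    · exact absurd h5.symm h6
    · exact absurd h6.symm h5
    · rfl
  simp_rw [h4, smul_ite, smul_zero]
  rw [Finset.sum_ite_eq']
  split_ifs with h5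
  · rfl
  · rw [MvPolynomial.homogeneousComponent_eq_zero _ _ (by simp at h5; omega), smul_zero]

/-! ### Barycentric coordinates -/

/-- Barycentric coordinates for the simplex with vertex set `K`, together with their gradients. -/
structure Barycentric (K : Finset (Space d)) where
  coord : Space d → Space d → ℝ
  grad : Space d → Space d
  coord_eq : ∀ p x y, coord p x = coord p y + inner ℝ (grad p) (x - y)
  coord_self : ∀ p ∈ K, coord p p = 1
  coord_ne : ∀ p ∈ K, ∀ q ∈ K, p ≠ q → coord p q = 0
  sum_coord : ∀ x, ∑ p ∈ K, coord p x = 1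
  sum_coord_smul : ∀ x, ∑ p ∈ K, coord p x • p = x
  hull_eq : hull K = {x | ∀ p ∈ K, 0 ≤ coord p x}
  interior_hull : interior (hull K) = {x | ∀ p ∈ K, 0 < coord p x}
  interior_nonempty : (interior (hull K)).Nonempty

/-- A nondegenerate `d`-simplex in `ℝᵈ`. -/
structure IsSimplex (K : Finset (Space d)) : Prop where
  indep : AffineIndependent ℝ ((↑) : K → Space d)
  card_eq : K.card = d + 1

lemma IsSimplex.nonempty_barycentric {K : Finset (Space d)} (hK : IsSimplex K) :
    Nonempty (Barycentric K) := by
  classical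
  have htot : affineSpan ℝ (Set.range ((↑) : K → Space d)) = ⊤ := by
    rw [hK.indep.affineSpan_eq_top_iff_card_eq_finrank_add_one]
    simp [hK.card_eq]
  let b : AffineBasis K ℝ (Space d) := ⟨_, hK.indep, htot⟩
  have hb : ∀ p : K, b p = p := fun _ => rfl
  have hrange : Set.range b = (K : Set (Space d)) := by
    ext x
    exact ⟨fun ⟨p, hp⟩ => hp ▸ p.2, fun h => ⟨⟨x, h⟩, rfl⟩⟩
  have hhull : hull K = convexHull ℝ (Set.range b) := by rw [hrange]; rfl
  let g : K → Space d := fun p =>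
    (InnerProductSpace.toDual ℝ (Space d)).symm (LinearMap.toContinuousLinearMap (b.coord p).linear)
  have hg : ∀ (p : K) x y, b.coord p x = b.coord p y + inner ℝ (g p) (x - y) := by
    intro p x y
    have h1 := (b.coord p).linearMap_vsub x y
    have h2 : inner ℝ (g p) (x - y) = (b.coord p).linear (x - y) := by
      simp [g]
    rw [h2, ← vsub_eq_sub x y, h1]
    simp
  -- The value zero at points outside `K` lets `coord_eq` hold without a membership hypothesis.
  refine ⟨⟨fun p x => if h : p ∈ K then b.coord ⟨p, h⟩ x else 0,
    fun p => if h : p ∈ K then g ⟨p, h⟩ else 0, ?_, ?_, ?_, ?_, ?_, ?_, ?_, ?_⟩⟩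
  · intro p x y
    split_ifs with h
    · exact hg _ x y
    · simp
  · intro p hp
    simp only [hp, dif_pos]
    exact b.coord_apply_eq ⟨p, hp⟩
  · intro p hp q hq hpq
    simp only [hp, dif_pos]
    exact b.coord_apply_ne (i := ⟨p, hp⟩) (j := ⟨q, hq⟩) (by simpa using hpq)
  · intro x
    rw [← b.sum_coord_apply_eq_one x, ← Finset.sum_coe_sort K]
    exact Finset.sum_congr rfl fun p _ => by simp
  · intro x
    conv_rhs => rw [← b.linear_combination_coord_eq_self x]
    rw [← Finset.sum_coe_sort K]
    exact Finset.sum_congr rfl fun p _ => by simp [hb]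
  · rw [hhull, b.convexHull_eq_nonneg_coord]
    ext x
    exact ⟨fun h p hp => by simpa [hp] using h ⟨p, hp⟩, fun h p => by simpa using h p p.2⟩
  · rw [hhull, b.interior_convexHull]
    ext x
    exact ⟨fun h p hp => by simpa [hp] using h ⟨p, hp⟩, fun h p => by simpa using h p p.2⟩
  · rw [hhull]
    exact ⟨_, b.centroid_mem_interior_convexHull⟩

namespace Barycentric

variable {K : Finset (Space d)} (B : Barycentric K)

lemma continuous_coord (p : Space d) : Continuous (B.coord p) := by
  have : B.coord p = fun x => B.coord p 0 + inner ℝ (B.grad p) (x - 0) := by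
    ext x; exact B.coord_eq p x 0
  rw [this]
  fun_prop

lemma coord_sub (p x y : Space d) : B.coord p x - B.coord p y = inner ℝ (B.grad p) (x - y) := by
  rw [B.coord_eq p x y]; ring

/-- An affine function commutes with the affine combination `x = ∑ λ_p(x) p`, so it is the
interpolant of its vertex values. -/
lemma sum_coord_mul {g : Space d → ℝ} {c : ℝ} {v : Space d} (hg : ∀ x, g x = c + inner ℝ v x)
    (x : Space d) : ∑ p ∈ K, B.coord p x * g p = g x := by
  simp_rw [hg, mul_add, Finset.sum_add_distrib, ← Finset.sum_mul, B.sum_coord x, one_mul]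
  conv_rhs => rw [← B.sum_coord_smul x]
  rw [inner_sum]
  simp_rw [inner_smul_right]

lemma sum_grad : ∑ p ∈ K, B.grad p = 0 := by
  refine ext_inner_right ℝ fun v => ?_
  have h : ∀ p, inner ℝ (B.grad p) v = B.coord p v - B.coord p 0 := fun p => by
    rw [B.coord_sub]; simp
  rw [sum_inner]
  simp [h, B.sum_coord]

lemma sum_inner_grad_smul (v : Space d) : ∑ p ∈ K, inner ℝ (B.grad p) v • p = v := by
  have h : ∀ p, inner ℝ (B.grad p) v = B.coord p v - B.coord p 0 := fun p => by
    rw [B.coord_sub]; simp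
  simp [h, sub_smul, B.sum_coord_smul]

lemma coord_comb (q p z : Space d) (t : ℝ) :
    B.coord q (p + t • (z - p)) = (1 - t) * B.coord q p + t * B.coord q z := by
  rw [B.coord_eq q (p + t • (z - p)) p, B.coord_eq q z p, add_sub_cancel_left, inner_smul_right]
  ring

variable [DecidableEq (Space d)]

/-- A facet is where the opposite coordinate vanishes: the convex combination representing such a
point does not use `p`. -/
lemma hull_erase {p : Space d} (hp : p ∈ K) :
    hull (K.erase p) = {x | x ∈ hull K ∧ B.coord p x = 0} := by
  ext x
  constructor
  · intro hx
    refine ⟨convexHull_mono (by simp) hx, ?_⟩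
    have h1 : Convex ℝ {x | B.coord p x = 0} := by
      have h2 : {x | B.coord p x = 0} = {x | inner ℝ (B.grad p) x = - B.coord p 0} := by
        ext y
        simp only [Set.mem_ofPred_eq]
        rw [B.coord_eq p y 0, sub_zero]
        constructor <;> intro h <;> linarith
      rw [h2]
      exact convex_hyperplane (f := fun x => inner ℝ (B.grad p) x)
        (IsLinearMap.mk (fun x y => inner_add_right _ _ _) (fun c x => inner_smul_right _ _ _)) _
    refine convexHull_min (fun q hq => ?_) h1 hx
    have hq' := Finset.mem_erase.1 (Finset.mem_coe.1 hq)
    exact B.coord_ne p hp q hq'.2 (Ne.symm hq'.1)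
  · rintro ⟨hx, hx0⟩
    rw [B.hull_eq] at hx
    have h1 : ∑ q ∈ K.erase p, B.coord q x = 1 := by
      rw [← B.sum_coord x, ← Finset.add_sum_erase K _ hp, hx0, zero_add]
    have h2 : ∑ q ∈ K.erase p, B.coord q x • q = x := by
      conv_rhs => rw [← B.sum_coord_smul x, ← Finset.add_sum_erase K _ hp, hx0, zero_smul, zero_add]
    have h3 := (convex_convexHull ℝ (K.erase p : Set (Space d))).sum_mem (t := K.erase p)
      (w := fun q => B.coord q x) (z := id)
      (fun q hq => hx q (Finset.mem_of_mem_erase hq)) h1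
      (fun q hq => subset_convexHull ℝ _ hq)
    simp only [id_eq, h2] at h3
    exact h3

variable {ν : Space d}

/-- The scalar product of a facet normal with the edges to the opposite vertex. -/
lemma exists_normal_eq (hd : 1 ≤ d) (hcard : K.card = d + 1) {p : Space d} (hp : p ∈ K)
    (hν : IsUnitNormal (K.erase p) ν) :
    ∃ a : ℝ, a ≠ 0 ∧ ν = a • B.grad p := by
  obtain ⟨q, hq⟩ : (K.erase p).Nonempty := by
    rw [← Finset.card_pos, Finset.card_erase_of_mem hp]; omega
  have hq' := Finset.mem_erase.1 hq
  -- The affine function `ν · (x - q)` vanishes at every vertex except `p`, hence is a multiple of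
  -- `λ_p`.
  have key : ∀ x, inner ℝ ν (x - q) = inner ℝ ν (p - q) * B.coord p x := by
    intro x
    have h1 := B.sum_coord_mul (g := fun x => inner ℝ ν (x - q)) (c := - inner ℝ ν q) (v := ν)
      (fun x => by rw [inner_sub_right]; ring) x
    rw [← h1, ← Finset.add_sum_erase K _ hp, Finset.sum_eq_zero, add_zero, mul_comm]
    intro r hr
    rw [hν.2 r hr q hq, mul_zero]
  have hgrad : ν = inner ℝ ν (p - q) • B.grad p := by
    refine ext_inner_right ℝ fun v => ?_
    have h1 := key (q + v)
    have h2 := B.coord_eq p (q + v) q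
    rw [B.coord_ne p hp q hq'.2 (Ne.symm hq'.1)] at h2
    rw [h2] at h1
    simp only [add_sub_cancel_left, zero_add] at h1
    rw [h1, inner_smul_left]; rfl
  refine ⟨_, fun h0 => ?_, hgrad⟩
  rw [h0, zero_smul] at hgrad
  have := hν.1
  rw [hgrad, norm_zero] at this
  exact zero_ne_one this

/-- Since `λ_p` drops from `1` at `p` to `0` on the facet, `ν · (p - x) = a` for every vertex `x` of
the facet. -/
lemma isOutwardNormal_iff (hd : 1 ≤ d) (hcard : K.card = d + 1) {p : Space d} (hp : p ∈ K)
    (hν : IsUnitNormal (K.erase p) ν) {a : ℝ} (ha : ν = a • B.grad p) :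
    IsOutwardNormal K (K.erase p) ν ↔ a < 0 := by
  obtain ⟨q, hq⟩ : (K.erase p).Nonempty := by
    rw [← Finset.card_pos, Finset.card_erase_of_mem hp]; omega
  have key : ∀ x ∈ K.erase p, inner ℝ ν (p - x) = a := by
    intro x hx
    have hx' := Finset.mem_erase.1 hx
    rw [ha, inner_smul_left, ← B.coord_sub, B.coord_self p hp,
      B.coord_ne p hp x hx'.2 (Ne.symm hx'.1)]
    simp
  constructor
  · intro h
    rw [← key q hq]
    exact h.2 p hp (by simp) q hq
  · refine fun h => ⟨hν, fun r hr hrF x hx => ?_⟩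
    have : r = p := by
      by_contra hne
      exact hrF (Finset.mem_erase.2 ⟨hne, hr⟩)
    rw [this, key x hx]
    exact h

/-- This absorbs the orientation: the cone formula produces `|a|`, while boundary terms carry the
sign of the element and `ν = a ∇λ_p`. -/
lemma signOf_mul (hd : 1 ≤ d) (hcard : K.card = d + 1) {p : Space d} (hp : p ∈ K)
    (hν : IsUnitNormal (K.erase p) ν) {a : ℝ} (ha : ν = a • B.grad p) :
    signOf K (K.erase p) ν * a = - |a| := by
  unfold signOf
  rw [B.isOutwardNormal_iff hd hcard hp hν ha]
  split_ifs with h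
  · rw [abs_of_neg h]; ring
  · rw [abs_of_nonneg (not_lt.1 h)]; ring

end Barycentric

/-! ### Surface measure and integration over cones -/

lemma finrank_orthogonal_span {ν : Space d} (hν : ‖ν‖ = 1) :
    Module.finrank ℝ (ℝ ∙ ν)ᗮ = d - 1 := by
  have h1 := (ℝ ∙ ν).finrank_add_finrank_orthogonal
  rw [finrank_span_singleton (by rintro rfl; simp at hν), finrank_euclideanSpace_fin] at h1
  omega

lemma isometry_add_orthogonal (ν z : Space d) :
    Isometry (fun y : (ℝ ∙ ν)ᗮ => z + (y : Space d)) :=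
  (IsometryEquiv.addLeft z).isometry.comp isometry_subtype_coe

lemma isClosedEmbedding_add_orthogonal (ν z : Space d) :
    Topology.IsClosedEmbedding (fun y : (ℝ ∙ ν)ᗮ => z + (y : Space d)) :=
  (isometry_add_orthogonal ν z).isClosedEmbedding

/-- The surface measure on a subset of a hyperplane, in Cartesian coordinates on it. -/
lemma restrict_euclideanHausdorffMeasure {ν z : Space d} (hν : ‖ν‖ = 1) {S : Set (Space d)}
    (hS : ∀ x ∈ S, inner ℝ ν (x - z) = 0) (hm : MeasurableSet S) :
    (Measure.euclideanHausdorffMeasure (d - 1) : Measure (Space d)).restrict S =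
      ((volume : Measure (ℝ ∙ ν)ᗮ).restrict ((fun y : (ℝ ∙ ν)ᗮ => z + (y : Space d)) ⁻¹' S)).map
        (fun y : (ℝ ∙ ν)ᗮ => z + (y : Space d)) := by
  rw [← (isClosedEmbedding_add_orthogonal ν z).measurableEmbedding.restrict_map,
    ← InnerProductSpace.euclideanHausdorffMeasure_eq_volume, finrank_orthogonal_span hν,
    (isometry_add_orthogonal ν z).map_euclideanHausdorffMeasure, Measure.restrict_restrict hm,
    Set.inter_eq_left.2]
  intro x hx
  refine ⟨⟨x - z, Submodule.mem_orthogonal_singleton_iff_inner_right.2 (hS x hx)⟩, ?_⟩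
  simp

/-- Fubini's theorem for a direction and its orthogonal complement. -/
lemma integral_eq_integral_integral_orthogonal {ν : Space d} (hν : ‖ν‖ = 1) (p : Space d)
    {H : Space d → ℝ} (hH : Integrable H) :
    ∫ x, H x = ∫ u : ℝ, ∫ y : (ℝ ∙ ν)ᗮ, H (p + u • ν + y) := by
  let σ := LinearIsometryEquiv.toSpanUnitSingleton (𝕜 := ℝ) ν hν
  have h1 : MeasurePreserving ((ℝ ∙ ν).measurableEquivProd p).symm volume volume := by
    have := ((ℝ ∙ ν).measurePreserving_measurableEquivProd p).symm
    rwa [InnerProductSpace.euclideanHausdorffMeasure_eq_volume] at this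
  have h2 : MeasurePreserving (Prod.map σ id : ℝ × (ℝ ∙ ν)ᗮ → (ℝ ∙ ν) × (ℝ ∙ ν)ᗮ)
      volume volume := σ.measurePreserving.prod (MeasurePreserving.id volume)
  have h3 := h1.comp h2
  have he : MeasurableEmbedding (((ℝ ∙ ν).measurableEquivProd p).symm ∘
      (Prod.map σ id : ℝ × (ℝ ∙ ν)ᗮ → (ℝ ∙ ν) × (ℝ ∙ ν)ᗮ)) :=
    (MeasurableEquiv.measurableEmbedding _).comp
      (σ.toHomeomorph.toMeasurableEquiv.prodCongr (MeasurableEquiv.refl _)).measurableEmbedding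
  have h4 : ∀ z : ℝ × (ℝ ∙ ν)ᗮ, (((ℝ ∙ ν).measurableEquivProd p).symm ∘
      (Prod.map σ id : ℝ × (ℝ ∙ ν)ᗮ → (ℝ ∙ ν) × (ℝ ∙ ν)ᗮ)) z = p + z.1 • ν + z.2 := by
    intro z
    simp [σ]
    abel
  have h5 := (h3.integrable_comp_emb he).2 hH
  rw [← h3.integral_comp he]
  rw [Function.comp_def] at h5
  simp_rw [h4] at h5 ⊢
  exact integral_prod _ h5

namespace Barycentric

variable {K : Finset (Space d)} (B : Barycentric K) {p ν : Space d} {a : ℝ}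

/-- The point `p - a ν` is the foot of the perpendicular from `p` to the hyperplane of the opposite
facet, because `a ∇λ_p · ν = |ν|² = 1`. Thus `|a|` is the height of the simplex over that facet. -/
lemma coord_foot (hp : p ∈ K) (hν : ‖ν‖ = 1) (ha : ν = a • B.grad p) (y : (ℝ ∙ ν)ᗮ) :
    B.coord p (p - a • ν + y) = 0 := by
  have hy : inner ℝ ν (y : Space d) = 0 := Submodule.mem_orthogonal_singleton_iff_inner_right.1 y.2
  have ha0 : a ≠ 0 := by
    rintro rfl
    rw [ha, zero_smul, norm_zero] at hν
    exact zero_ne_one hν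
  have hg : B.grad p = a⁻¹ • ν := by rw [ha, smul_smul, inv_mul_cancel₀ ha0, one_smul]
  rw [B.coord_eq p _ p, B.coord_self p hp, hg, inner_smul_left]
  have : p - a • ν + (y : Space d) - p = (y : Space d) - a • ν := by abel
  rw [this, inner_sub_right, hy, inner_smul_right, real_inner_self_eq_norm_sq, hν]
  simp [ha0]

lemma coord_le_one {x : Space d} (hp : p ∈ K) (hx : x ∈ hull K) : B.coord p x ≤ 1 := by
  rw [B.hull_eq] at hx
  rw [← B.sum_coord x]
  exact Finset.single_le_sum (f := fun q => B.coord q x) hx hp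

/-- At height parameter `t` the coordinate `λ_p` is `1 - t`, which exceeds `1` beyond the apex. -/
lemma notMem_hull_of_neg (hp : p ∈ K) (hν : ‖ν‖ = 1) (ha : ν = a • B.grad p) (y : (ℝ ∙ ν)ᗮ)
    {t : ℝ} (ht : t < 0) : p + (-a * t) • ν + (y : Space d) ∉ hull K := by
  intro h
  have h1 : p + (-a * t) • ν + (y : Space d) =
      p + t • ((p - a • ν + ((t⁻¹ • y : (ℝ ∙ ν)ᗮ) : Space d)) - p) := by
    simp only [Submodule.coe_smul, smul_sub, smul_add, smul_smul,
      mul_inv_cancel₀ ht.ne, one_smul]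
    module
  have h2 := B.coord_le_one hp h
  rw [h1, B.coord_comb, B.coord_foot hp hν ha, B.coord_self p hp] at h2
  linarith

variable [DecidableEq (Space d)]

/-- Moving from `p` towards a point of the opposite hyperplane turns `λ_p` into `1 - t` and
multiplies the other coordinates by `t`. -/
lemma mem_hull_cone_iff (hp : p ∈ K) (hν : ‖ν‖ = 1) (ha : ν = a • B.grad p) (y : (ℝ ∙ ν)ᗮ)
    {t : ℝ} (ht : 0 < t) :
    p + (-a * t) • ν + t • (y : Space d) ∈ hull K ↔
      t ≤ 1 ∧ p - a • ν + (y : Space d) ∈ hull (K.erase p) := by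
  have h1 : p + (-a * t) • ν + t • (y : Space d) = p + t • ((p - a • ν + (y : Space d)) - p) := by
    module
  have h0 := B.coord_foot hp hν ha y
  rw [h1, B.hull_erase hp, B.hull_eq]
  simp only [Set.mem_ofPred_eq, B.coord_comb, h0, and_true]
  constructor
  · intro h
    refine ⟨?_, fun q hq => ?_⟩
    · have := h p hp
      rw [B.coord_self p hp, h0] at this
      linarith
    · rcases eq_or_ne q p with rfl | hqp
      · exact h0.ge
      · have := h q hq
        rw [B.coord_ne q hq p hp hqp, mul_zero, zero_add] at this
        exact nonneg_of_mul_nonneg_right this ht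
  · rintro ⟨ht1, h⟩ q hq
    rcases eq_or_ne q p with rfl | hqp
    · rw [B.coord_self q hq, h0]; linarith
    · rw [B.coord_ne q hq p hp hqp, mul_zero, zero_add]
      exact mul_nonneg ht.le (h q hq)

end Barycentric

lemma isCompact_hull (K : Finset (Space d)) : IsCompact (hull K) :=
  K.finite_toSet.isCompact_convexHull ℝ

lemma measurableSet_hull (K : Finset (Space d)) : MeasurableSet (hull K) :=
  (isCompact_hull K).measurableSet

namespace Barycentric

variable {K : Finset (Space d)} (B : Barycentric K) [DecidableEq (Space d)]
  {p ν : Space d} {a : ℝ}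

/-- Fubini along `ν` from the apex, followed by `u = -a t` on the line and scaling by `t` in the
slice. The Jacobians are `|a|` and `t ^ (d - 1)`. -/
lemma integral_hull_eq_cone (hp : p ∈ K) (hν : ‖ν‖ = 1) (ha : ν = a • B.grad p)
    {G : Space d → ℝ} (hG : Continuous G) :
    ∫ x in hull K, G x = |a| * ∫ t in (0 : ℝ)..1,
      ∫ y in (fun y : (ℝ ∙ ν)ᗮ => p - a • ν + (y : Space d)) ⁻¹' hull (K.erase p),
        t ^ (d - 1) * G (p + t • ((p - a • ν + (y : Space d)) - p)) := by
  have ha0 : a ≠ 0 := by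
    rintro rfl
    rw [ha, zero_smul, norm_zero] at hν
    exact zero_ne_one hν
  set F' := (fun y : (ℝ ∙ ν)ᗮ => p - a • ν + (y : Space d)) ⁻¹' hull (K.erase p) with hF'
  have hF'm : MeasurableSet F' :=
    (isClosedEmbedding_add_orthogonal ν _).measurableEmbedding.measurable (measurableSet_hull _)
  have hint : Integrable ((hull K).indicator G) :=
    (hG.continuousOn.integrableOn_compact (isCompact_hull K)).integrable_indicator
      (measurableSet_hull K)
  rw [← integral_indicator (measurableSet_hull K),
    integral_eq_integral_integral_orthogonal hν p hint]
  have h1 := Measure.integral_comp_mul_left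
    (fun u : ℝ => ∫ y : (ℝ ∙ ν)ᗮ, (hull K).indicator G (p + u • ν + y)) (-a)
  rw [smul_eq_mul, abs_inv, abs_neg, eq_inv_mul_iff_mul_eq₀ (abs_ne_zero.2 ha0)] at h1
  rw [← h1, intervalIntegral.integral_of_le zero_le_one, ← integral_indicator measurableSet_Ioc]
  congr 1
  refine integral_congr_ae ?_
  have hne : ∀ᵐ t : ℝ, t ≠ 0 := by
    simp [ae_iff]
  filter_upwards [hne] with t ht
  rcases lt_or_gt_of_ne ht with hneg | hpos
  · rw [Set.indicator_of_notMem (by simp [hneg.le])]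
    rw [← integral_zero (ℝ ∙ ν)ᗮ ℝ (μ := volume)]
    refine integral_congr_ae (Filter.Eventually.of_forall fun y => ?_)
    exact Set.indicator_of_notMem (B.notMem_hull_of_neg hp hν ha y hneg) _
  · have h2 := Measure.integral_comp_smul (volume : Measure (ℝ ∙ ν)ᗮ)
      (fun y : (ℝ ∙ ν)ᗮ => (hull K).indicator G (p + (-a * t) • ν + y)) t
    rw [finrank_orthogonal_span hν, smul_eq_mul, abs_of_pos (by positivity),
      eq_inv_mul_iff_mul_eq₀ (by positivity)] at h2
    rw [← h2]
    by_cases ht1 : t ≤ 1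
    · rw [Set.indicator_of_mem (by simp [hpos, ht1]), integral_const_mul,
        ← integral_indicator hF'm]
      congr 1
      refine integral_congr_ae (Filter.Eventually.of_forall fun y => ?_)
      have h3 := B.mem_hull_cone_iff hp hν ha y hpos
      have h4 : p + (-a * t) • ν + t • (y : Space d) =
        p + t • ((p - a • ν + (y : Space d)) - p) := by module
      by_cases hy : y ∈ F'
      · dsimp only
        rw [Set.indicator_of_mem hy, Submodule.coe_smul, Set.indicator_of_mem (h3.2 ⟨ht1, hy⟩), h4]
      · dsimp only
        rw [Set.indicator_of_notMem hy, Submodule.coe_smul, Set.indicator_of_notMem]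
        exact fun h => hy (h3.1 h).2
    · rw [Set.indicator_of_notMem (by simp [ht1]), mul_eq_zero]
      right
      rw [← integral_zero (ℝ ∙ ν)ᗮ ℝ (μ := volume)]
      refine integral_congr_ae (Filter.Eventually.of_forall fun y => ?_)
      refine Set.indicator_of_notMem (fun h => ?_) _
      rw [Submodule.coe_smul] at h
      exact ht1 ((B.mem_hull_cone_iff hp hν ha y hpos).1 h).1

lemma inner_foot (hp : p ∈ K) (hν : ‖ν‖ = 1) (ha : ν = a • B.grad p) :
    ∀ x ∈ hull (K.erase p), inner ℝ ν (x - (p - a • ν)) = 0 := by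
  intro x hx
  rw [B.hull_erase hp] at hx
  have h1 := B.coord_foot hp hν ha 0
  rw [Submodule.coe_zero, add_zero] at h1
  have h2 : ∀ v, inner ℝ ν v = a * inner ℝ (B.grad p) v := fun v => by
    conv_lhs => rw [ha]
    exact real_inner_smul_left _ _ _
  rw [h2, ← B.coord_sub, hx.2, h1, sub_zero, mul_zero]

/-- The divergence theorem on a simplex for the field `f (x) (x - p)`, where `p` is a vertex: only
the facet opposite to `p` contributes. -/
lemma integral_radial (hd : 1 ≤ d) (hp : p ∈ K) (hν : ‖ν‖ = 1) (ha : ν = a • B.grad p)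
    {f : Space d → ℝ} (hf : ContDiff ℝ 1 f) :
    ∫ x in hull K, (d * f x + fderiv ℝ f x (x - p)) =
      |a| * ∫ x in hull (K.erase p), f x ∂(Measure.euclideanHausdorffMeasure (d - 1)) := by
  have hf' : Continuous (fderiv ℝ f) := hf.continuous_fderiv one_ne_zero
  have hG : Continuous fun x => d * f x + fderiv ℝ f x (x - p) :=
    (continuous_const.mul hf.continuous).add (hf'.clm_apply (by fun_prop))
  rw [B.integral_hull_eq_cone hp hν ha hG, restrict_euclideanHausdorffMeasure hν
    (B.inner_foot hp hν ha) (measurableSet_hull _),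
    (isClosedEmbedding_add_orthogonal ν _).measurableEmbedding.integral_map]
  congr 1
  set F' := (fun y : (ℝ ∙ ν)ᗮ => p - a • ν + (y : Space d)) ⁻¹' hull (K.erase p) with hF'
  have hF'c : IsCompact F' :=
    (isClosedEmbedding_add_orthogonal ν _).isCompact_preimage (isCompact_hull _)
  rw [intervalIntegral_integral_swap]
  · refine integral_congr_ae (Filter.Eventually.of_forall fun y => ?_)
    set z := p - a • ν + (y : Space d)
    -- On each ray the integrand is an exact derivative; at `t = 0` the factor `t ^ d` vanishes
    -- since `d ≥ 1`, so only `f z` remains.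
    have hder : ∀ t : ℝ, HasDerivAt (fun t : ℝ => t ^ d * f (p + t • (z - p)))
        (t ^ (d - 1) * (d * f (p + t • (z - p)) +
          fderiv ℝ f (p + t • (z - p)) (p + t • (z - p) - p))) t := by
      intro t
      have h1 : HasDerivAt (fun t : ℝ => p + t • (z - p)) (z - p) t := by
        simpa using ((hasDerivAt_id t).smul_const (z - p)).const_add p
      have h2 := ((hf.differentiable one_ne_zero) (p + t • (z - p))).hasFDerivAt.comp_hasDerivAt t h1
      refine ((hasDerivAt_pow d t).mul h2).congr_deriv ?_
      obtain ⟨m, rfl⟩ : ∃ m, d = m + 1 := ⟨d - 1, by omega⟩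
      simp [pow_succ]
      ring
    dsimp only
    rw [intervalIntegral.integral_eq_sub_of_hasDerivAt (fun t _ => hder t)]
    · simp [show d ≠ 0 by omega, z]
    · refine Continuous.intervalIntegrable ?_ _ _
      exact (by fun_prop : Continuous fun t : ℝ => t ^ (d - 1)).mul (hG.comp (by fun_prop))
  · rw [Set.uIoc_of_le zero_le_one, Measure.prod_restrict]
    have hc : IsCompact (Set.Icc (0 : ℝ) 1 ×ˢ F') := isCompact_Icc.prod hF'c
    refine IntegrableOn.mono_set (ContinuousOn.integrableOn_compact hc ?_)
      (Set.prod_mono Set.Ioc_subset_Icc_self le_rfl)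
    refine Continuous.continuousOn ?_
    change Continuous fun w : ℝ × (ℝ ∙ ν)ᗮ => w.1 ^ (d - 1) *
      (fun x => d * f x + fderiv ℝ f x (x - p)) (p + w.1 • ((p - a • ν + (w.2 : Space d)) - p))
    exact (by fun_prop : Continuous fun w : ℝ × (ℝ ∙ ν)ᗮ => w.1 ^ (d - 1)).mul
      (hG.comp (by fun_prop))

end Barycentric

/-! ### The divergence theorem on a simplex -/

/-- The integral gives vanishing almost everywhere only. A convex set with interior points lies in
the closure of its interior, so continuity extends this to all of `S`, boundary included. -/
lemma eqOn_zero_of_setIntegral_eq_zero {E : Type*} [NormedAddCommGroup E]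
    [NormedSpace ℝ E] [MeasurableSpace E] [BorelSpace E] {μ : Measure E} [μ.IsOpenPosMeasure]
    [IsFiniteMeasureOnCompacts μ] {S : Set E} (hS : Convex ℝ S) (hc : IsCompact S)
    (hi : (interior S).Nonempty) {f : E → ℝ} (hf : Continuous f) (h0 : ∀ x ∈ S, 0 ≤ f x)
    (h : ∫ x in S, f x ∂μ = 0) : ∀ x ∈ S, f x = 0 := by
  have hae : 0 ≤ᵐ[μ.restrict S] f :=
    (ae_restrict_iff' hc.measurableSet).2 (Filter.Eventually.of_forall h0)
  rw [setIntegral_eq_zero_iff_of_nonneg_ae hae (hf.continuousOn.integrableOn_compact hc)] at h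
  refine Measure.eqOn_of_ae_eq (g := 0) h hf.continuousOn continuousOn_const ?_
  rw [hS.closure_interior_eq_closure_of_nonempty_interior hi]
  exact subset_closure

namespace Barycentric

variable {K : Finset (Space d)} (B : Barycentric K)

include B in
lemma eqOn_zero_of_integral_hull_eq_zero {f : Space d → ℝ} (hf : Continuous f)
    (h0 : ∀ x ∈ hull K, 0 ≤ f x) (h : ∫ x in hull K, f x = 0) : ∀ x ∈ hull K, f x = 0 :=
  eqOn_zero_of_setIntegral_eq_zero (convex_convexHull ℝ _) (isCompact_hull K)
    B.interior_nonempty hf h0 h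

variable [DecidableEq (Space d)] {p ν : Space d}

/-- The relative interior of the facet opposite to `p`. -/
def facetInterior (p : Space d) : Set (Space d) :=
  {x | B.coord p x = 0 ∧ ∀ q ∈ K.erase p, 0 < B.coord q x}

lemma facetInterior_nonempty (hd : 1 ≤ d) (hcard : K.card = d + 1) (hp : p ∈ K) :
    (B.facetInterior p).Nonempty := by
  obtain ⟨q, hq⟩ : (K.erase p).Nonempty := by
    rw [← Finset.card_pos, Finset.card_erase_of_mem hp]; omega
  obtain ⟨x, hx⟩ := B.interior_nonempty
  rw [B.interior_hull] at hx
  have h1 : 0 < ∑ q ∈ K.erase p, B.coord q x :=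
    Finset.sum_pos (fun q hq => hx q (Finset.mem_of_mem_erase hq)) ⟨q, hq⟩
  have h2 := B.sum_coord x
  rw [← Finset.add_sum_erase K _ hp] at h2
  -- Central projection of an interior point from `p` onto the opposite facet.
  refine ⟨p + (1 - B.coord p x)⁻¹ • (x - p), ?_, fun r hr => ?_⟩
  · rw [B.coord_comb, B.coord_self p hp]
    have h3 : 1 - B.coord p x ≠ 0 := by linarith
    field_simp
    ring
  · have hr' := Finset.mem_erase.1 hr
    rw [B.coord_comb, B.coord_ne r hr'.2 p hp hr'.1, mul_zero, zero_add]
    have h3 : 0 < 1 - B.coord p x := by linarith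
    exact mul_pos (inv_pos.2 h3) (hx r hr'.2)

lemma facetInterior_subset (hp : p ∈ K) : B.facetInterior p ⊆ hull (K.erase p) := by
  intro x hx
  rw [B.hull_erase hp, B.hull_eq]
  refine ⟨fun q hq => ?_, hx.1⟩
  rcases eq_or_ne q p with rfl | hqp
  · exact hx.1.ge
  · exact (hx.2 q (Finset.mem_erase.2 ⟨hqp, hq⟩)).le

lemma hull_erase_subset_closure (hd : 1 ≤ d) (hcard : K.card = d + 1) (hp : p ∈ K) :
    hull (K.erase p) ⊆ closure (B.facetInterior p) := by
  intro x hx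
  obtain ⟨c, hc⟩ := B.facetInterior_nonempty hd hcard hp
  rw [B.hull_erase hp, B.hull_eq] at hx
  have h1 : Filter.Tendsto (fun t : ℝ => x + t • (c - x)) (nhdsWithin 0 (Set.Ioi 0)) (nhds x) := by
    have : Continuous fun t : ℝ => x + t • (c - x) := by fun_prop
    simpa using (this.tendsto 0).mono_left nhdsWithin_le_nhds
  refine mem_closure_of_tendsto h1 ?_
  filter_upwards [Ioo_mem_nhdsGT (zero_lt_one' ℝ)] with t ht
  refine ⟨?_, fun q hq => ?_⟩
  · rw [B.coord_comb, hx.2, hc.1]; simp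
  · rw [B.coord_comb]
    have h2 := hx.1 q (Finset.mem_of_mem_erase hq)
    have h3 := hc.2 q hq
    have h4 : 0 < 1 - t := by linarith [ht.2]
    have h5 := ht.1
    positivity

variable (hd : 1 ≤ d) (hcard : K.card = d + 1) (hp : p ∈ K) (hν : IsUnitNormal (K.erase p) ν)
  {f : Space d → ℝ}

include B hd hcard hp hν

lemma integrableOn_facet (hf : Continuous f) :
    IntegrableOn f (hull (K.erase p)) (Measure.euclideanHausdorffMeasure (d - 1)) := by
  obtain ⟨a, -, ha⟩ := B.exists_normal_eq hd hcard hp hν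
  rw [IntegrableOn, restrict_euclideanHausdorffMeasure hν.1 (B.inner_foot hp hν.1 ha)
    (measurableSet_hull _),
    (isClosedEmbedding_add_orthogonal ν _).measurableEmbedding.integrable_map_iff]
  refine Continuous.continuousOn ?_ |>.integrableOn_compact
    ((isClosedEmbedding_add_orthogonal ν _).isCompact_preimage (isCompact_hull _))
  exact hf.comp (isClosedEmbedding_add_orthogonal ν _).continuous

/-- The facet has empty interior in the ambient space, so the argument is carried out in `(ℝ ∙ ν)ᗮ`,
where its copy has interior points. -/
lemma eqOn_zero_of_integral_facet_eq_zero (hf : Continuous f)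
    (h0 : ∀ x ∈ hull (K.erase p), 0 ≤ f x)
    (h : ∫ x in hull (K.erase p), f x ∂(Measure.euclideanHausdorffMeasure (d - 1)) = 0) :
    ∀ x ∈ hull (K.erase p), f x = 0 := by
  obtain ⟨a, -, ha⟩ := B.exists_normal_eq hd hcard hp hν
  have hj := isClosedEmbedding_add_orthogonal ν (p - a • ν)
  have hfoot := B.inner_foot hp hν.1 ha
  rw [restrict_euclideanHausdorffMeasure hν.1 hfoot (measurableSet_hull _),
    hj.measurableEmbedding.integral_map] at h
  have hlift : ∀ x ∈ hull (K.erase p), ∃ y : (ℝ ∙ ν)ᗮ, p - a • ν + (y : Space d) = x := by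
    intro x hx
    exact ⟨⟨x - (p - a • ν), Submodule.mem_orthogonal_singleton_iff_inner_right.2 (hfoot x hx)⟩,
      by simp⟩
  have hconv : Convex ℝ ((fun y : (ℝ ∙ ν)ᗮ => p - a • ν + (y : Space d)) ⁻¹' hull (K.erase p)) := by
    have h1 := (convex_convexHull ℝ (K.erase p : Set (Space d))).translate_preimage_right
      (p - a • ν)
    exact h1.linear_preimage (ℝ ∙ ν)ᗮ.subtype
  have hint : (interior ((fun y : (ℝ ∙ ν)ᗮ => p - a • ν + (y : Space d)) ⁻¹'
      hull (K.erase p))).Nonempty := by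
    obtain ⟨c, hc⟩ := B.facetInterior_nonempty hd hcard hp
    obtain ⟨y, hy⟩ := hlift c (B.facetInterior_subset hp hc)
    refine ⟨y, mem_interior_iff_mem_nhds.2 ?_⟩
    have h1 : ∀ᶠ x in nhds c, ∀ q ∈ K.erase p, 0 < B.coord q x := by
      rw [Filter.eventually_all_finset]
      exact fun q hq => (B.continuous_coord q).continuousAt.eventually_const_lt (hc.2 q hq)
    rw [← hy] at h1
    filter_upwards [(hj.continuous.tendsto y).eventually h1] with y' hy'
    exact B.facetInterior_subset hp ⟨B.coord_foot hp hν.1 ha y', hy'⟩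
  have h2 := eqOn_zero_of_setIntegral_eq_zero hconv (hj.isCompact_preimage (isCompact_hull _)) hint
    (hf.comp hj.continuous) (fun y hy => h0 _ hy) h
  intro x hx
  obtain ⟨y, rfl⟩ := hlift x hx
  exact h2 y hx

end Barycentric

namespace Barycentric

variable {K : Finset (Space d)} (B : Barycentric K) [DecidableEq (Space d)]
  (hd : 1 ≤ d) (hcard : K.card = d + 1) {ν : Space d → Space d}
  (hν : ∀ p ∈ K, IsUnitNormal (K.erase p) (ν p))

include B hd hcard hν

/-- Because `∑ ∇λ_p = 0` and `∑ (∇λ_p · e) p = e`, a constant vector is the combination `e = -∑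
(∇λ_p · e) (x - p)` of radial fields, each of which contributes on a single facet by
`integral_radial`. The terms `d * f x` cancel in the sum. -/
lemma integral_fderiv {f : Space d → ℝ} (hf : ContDiff ℝ 1 f) (e : Space d) :
    ∫ x in hull K, fderiv ℝ f x e = ∑ p ∈ K, signOf K (K.erase p) (ν p) * inner ℝ (ν p) e *
      ∫ x in hull (K.erase p), f x ∂(Measure.euclideanHausdorffMeasure (d - 1)) := by
  have hf' : Continuous (fderiv ℝ f) := hf.continuous_fderiv one_ne_zero
  have h1 : ∀ x, fderiv ℝ f x e =
      ∑ p ∈ K, -inner ℝ (B.grad p) e * (d * f x + fderiv ℝ f x (x - p)) := by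
    intro x
    have h2 : e = ∑ p ∈ K, -inner ℝ (B.grad p) e • (x - p) := by
      have h3 := B.sum_inner_grad_smul e
      have h4 : ∑ p ∈ K, inner ℝ (B.grad p) e = 0 := by
        rw [← sum_inner, B.sum_grad, inner_zero_left]
      simp only [smul_sub, neg_smul, Finset.sum_sub_distrib, Finset.sum_neg_distrib, h3,
        ← Finset.sum_smul, h4]
      simp
    have h4 : ∑ p ∈ K, inner ℝ (B.grad p) e = 0 := by
      rw [← sum_inner, B.sum_grad, inner_zero_left]
    simp only [mul_add, Finset.sum_add_distrib, ← Finset.sum_mul, Finset.sum_neg_distrib, h4]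
    conv_lhs => rw [h2]
    simp
  simp_rw [h1]
  rw [integral_finsetSum]
  · refine Finset.sum_congr rfl fun p hp => ?_
    obtain ⟨a, -, ha⟩ := B.exists_normal_eq hd hcard hp (hν p hp)
    rw [integral_const_mul, B.integral_radial hd hp (hν p hp).1 ha hf, ← mul_assoc]
    congr 1
    have h5 : inner ℝ (ν p) e = a * inner ℝ (B.grad p) e := by
      conv_lhs => rw [ha]
      exact real_inner_smul_left _ _ _
    rw [h5, ← mul_assoc, B.signOf_mul hd hcard hp (hν p hp) ha]
    ring
  · intro p _
    refine Continuous.continuousOn ?_ |>.integrableOn_compact (isCompact_hull K)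
    exact continuous_const.mul ((continuous_const.mul hf.continuous).add
      (hf'.clm_apply (by fun_prop)))

lemma integral_divergence {φ : Space d → ℝ} (hφ : ContDiff ℝ 1 φ) (q : PolyField d) :
    ∫ x in hull K, (fderiv ℝ φ x (q.val x) + φ x * q.div.val x) =
      ∑ p ∈ K, ∫ x in hull (K.erase p),
        φ x * (signOf K (K.erase p) (ν p) * inner ℝ (q.val x) (ν p))
          ∂(Measure.euclideanHausdorffMeasure (d - 1)) := by
  let b : Fin d → Space d := fun i => EuclideanSpace.single i 1
  have hprod : ∀ i, ContDiff ℝ 1 fun x => φ x * (q i).val x :=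
    fun i => hφ.mul (Poly.contDiff_val (q i))
  have h1 : ∀ x, fderiv ℝ φ x (q.val x) + φ x * q.div.val x =
      ∑ i, fderiv ℝ (fun x => φ x * (q i).val x) x (b i) := by
    intro x
    have hq : q.val x = ∑ i, (q i).val x • b i := by
      ext j
      simp [b, Finset.sum_apply, Pi.single_apply]
    have h2 : ∀ i, fderiv ℝ (fun x => φ x * (q i).val x) x (b i) =
        (q i).val x * fderiv ℝ φ x (b i) + φ x * Poly.val (MvPolynomial.pderiv i (q i)) x := by
      intro i
      rw [fderiv_fun_mul ((hφ.differentiable one_ne_zero) x)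
        ((Poly.contDiff_val (q i) (n := 1)).differentiable one_ne_zero x)]
      simp [Poly.fderiv_val, b, add_comm]
    simp_rw [h2, Finset.sum_add_distrib, ← Finset.mul_sum]
    rw [hq, map_sum, PolyField.div, Poly.val_sum]
    simp
  simp_rw [h1]
  have hcont : ∀ i, Continuous fun x => fderiv ℝ (fun x => φ x * (q i).val x) x (b i) :=
    fun i => ((hprod i).continuous_fderiv one_ne_zero).clm_apply continuous_const
  rw [integral_finsetSum _ fun i _ => (hcont i).continuousOn.integrableOn_compact
    (isCompact_hull K)]
  simp_rw [B.integral_fderiv hd hcard hν (hprod _)]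
  rw [Finset.sum_comm]
  refine Finset.sum_congr rfl fun p hp => ?_
  simp_rw [← integral_const_mul]
  rw [← integral_finsetSum _ fun i _ => (B.integrableOn_facet hd hcard hp (hν p hp)
    (hprod i).continuous).const_mul _]
  congr 1
  ext x
  have h3 : inner ℝ (q.val x) (ν p) = ∑ i, (q i).val x * inner ℝ (ν p) (b i) := by
    simp [PiLp.inner_apply, b, mul_comm]
  rw [h3, Finset.mul_sum, Finset.mul_sum]
  exact Finset.sum_congr rfl fun i _ => by ring

end Barycentric

/-! ### Unisolvence of the local Raviart-Thomas space -/

lemma localRT_sub {s : ℕ} {q q' : PolyField d} (hq : q ∈ localRT d s) (hq' : q' ∈ localRT d s) :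
    q - q' ∈ localRT d s := by
  obtain ⟨a, ha, b, hb, h⟩ := hq
  obtain ⟨a', ha', b', hb', h'⟩ := hq'
  refine ⟨a - a', fun i => (MvPolynomial.totalDegree_sub _ _).trans (max_le (ha i) (ha' i)),
    b - b', (MvPolynomial.totalDegree_sub _ _).trans (max_le hb hb'), fun i => ?_⟩
  simp only [Pi.sub_apply, h i, h' i]
  ring

lemma totalDegree_div_le {s : ℕ} {q : PolyField d} (hq : q ∈ localRT d s) :
    q.div.totalDegree ≤ s := by
  obtain ⟨a, ha, b, hb, h⟩ := hq
  refine (MvPolynomial.totalDegree_finsetSum _ _).trans (Finset.sup_le fun i _ => ?_)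
  refine (totalDegree_pderiv_le i (q i)).trans ?_
  have h1 : (q i).totalDegree ≤ s + 1 := by
    rw [h i]
    refine (MvPolynomial.totalDegree_add _ _).trans (max_le ((ha i).trans (Nat.le_succ s)) ?_)
    refine (MvPolynomial.totalDegree_mul _ _).trans ?_
    rw [MvPolynomial.totalDegree_X]
    omega
  omega

/-- A divergence-free field in `P_s ^ d + x P_s` lies in `P_s ^ d`. -/
lemma totalDegree_le_of_div_eq_zero (hd : 1 ≤ d) {s : ℕ} {q : PolyField d}
    (hq : q ∈ localRT d s) (hdiv : q.div = 0) (i : Fin d) : (q i).totalDegree ≤ s := by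
  obtain ⟨a, ha, b, hb, h⟩ := hq
  have h1 : q.div = ∑ i, MvPolynomial.pderiv i (a i) +
      ∑ i, MvPolynomial.pderiv i (MvPolynomial.X i * b) := by
    simp only [PolyField.div, h, map_add, Finset.sum_add_distrib]
  -- In degree `s` the equation `div q = 0` reads `(d + s) b_s = 0`, and `d + s > 0`.
  have h2 : MvPolynomial.homogeneousComponent s b = 0 := by
    have h3 := congrArg (MvPolynomial.homogeneousComponent s) h1
    rw [hdiv, map_zero, map_add, map_sum, Finset.sum_eq_zero
      fun i _ => homogeneousComponent_pderiv_eq_zero (ha i), zero_add,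
      homogeneousComponent_div_X_mul] at h3
    refine (smul_eq_zero.1 h3.symm).resolve_left ?_
    exact_mod_cast (by omega : d + s ≠ 0)
  rw [h i]
  refine (MvPolynomial.totalDegree_add _ _).trans (max_le (ha i) ?_)
  rcases eq_or_ne s 0 with rfl | hs
  · have hb0 : b = 0 := by
      rw [MvPolynomial.homogeneousComponent_zero] at h2
      rw [MvPolynomial.totalDegree_eq_zero_iff_eq_C.1 (Nat.le_zero.1 hb)]
      exact h2
    simp [hb0]
  · have := totalDegree_lt_of_homogeneousComponent_eq_zero hs hb h2
    refine (MvPolynomial.totalDegree_mul _ _).trans ?_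
    rw [MvPolynomial.totalDegree_X]
    omega

/-- Induction on the degree. With `ℓ = c + g · x` and `y = x - ℓ w`, one has `x_i m(x) - y_i m(y) =
ℓ w_i m(x) + y_i (m(x) - m(y))`, which gives the new quotient. The alternative `r = 0` is needed
because no polynomial has degree below `0`. -/
lemma exists_sub_eq_affine_mul_monomial (c : ℝ) (g w : Space d) (n : ℕ) :
    ∀ m : Fin d →₀ ℕ, m.degree = n → ∃ r : Poly d, (r = 0 ∨ r.totalDegree < n) ∧
      ∀ x, Poly.val (MvPolynomial.monomial m 1) x -
        Poly.val (MvPolynomial.monomial m 1) (x - (c + inner ℝ g x) • w) =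
          (c + inner ℝ g x) * r.val x := by
  induction n with
  | zero =>
    intro m hm
    rw [Finsupp.degree_eq_zero_iff] at hm
    subst hm
    exact ⟨0, Or.inl rfl, fun x => by simp [Poly.val]⟩
  | succ n ih =>
    intro m hm
    obtain ⟨i, hi⟩ : ∃ i, m i ≠ 0 := by
      by_contra! h
      rw [show m = 0 from Finsupp.ext h] at hm
      simp at hm
    have h2 : m = (m - Finsupp.single i 1) + Finsupp.single i 1 := by
      ext j
      by_cases hj : i = j
      · subst hj; simp; omega
      · simp [hj]
    have h3 : Finsupp.degree (m - Finsupp.single i 1) = n := by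
      have := congrArg Finsupp.degree h2
      rw [hm, map_add] at this
      simpa using this.symm
    obtain ⟨r, hr, hx⟩ := ih _ h3
    have h4 : (MvPolynomial.monomial m 1 : Poly d) =
        MvPolynomial.monomial (m - Finsupp.single i 1) 1 * MvPolynomial.X i := by
      conv_lhs => rw [h2]
      rw [MvPolynomial.X, MvPolynomial.monomial_mul, one_mul]
    refine ⟨MvPolynomial.C (w i) * MvPolynomial.monomial (m - Finsupp.single i 1) 1 +
      (MvPolynomial.X i - MvPolynomial.C (w i) * Poly.affine c g) * r, Or.inr ?_, fun x => ?_⟩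
    · refine Nat.lt_succ_of_le ((MvPolynomial.totalDegree_add _ _).trans (max_le ?_ ?_))
      · refine (MvPolynomial.totalDegree_mul _ _).trans ?_
        rw [MvPolynomial.totalDegree_C, zero_add]
        exact (MvPolynomial.totalDegree_monomial_le _ _).trans h3.le
      · rcases hr with rfl | hr
        · simp
        · refine (MvPolynomial.totalDegree_mul _ _).trans ?_
          have h5 : (MvPolynomial.X i - MvPolynomial.C (w i) * Poly.affine c g :
              Poly d).totalDegree ≤ 1 := by
            refine (MvPolynomial.totalDegree_sub _ _).trans (max_le (by simp) ?_)
            refine (MvPolynomial.totalDegree_mul _ _).trans ?_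
            rw [MvPolynomial.totalDegree_C, zero_add]
            exact Poly.totalDegree_affine c g
          omega
    · rw [h4]
      have := hx x
      simp only [Poly.val_add, Poly.val_sub, Poly.val_mul, Poly.val_C, Poly.val_X,
        Poly.val_affine, PiLp.sub_apply, PiLp.smul_apply, smul_eq_mul]
      linear_combination (x i - (c + inner ℝ g x) * w i) * this

/-- The difference of the values of a polynomial at a point and at its projection to a hyperplane
is divisible by the equation of the hyperplane. -/
lemma exists_sub_eq_affine_mul (c : ℝ) (g w : Space d) {s : ℕ} {p : Poly d}
    (hp : p.totalDegree ≤ s) : ∃ r : Poly d, (r = 0 ∨ r.totalDegree < s) ∧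
      ∀ x, p.val x - p.val (x - (c + inner ℝ g x) • w) = (c + inner ℝ g x) * r.val x := by
  choose r hr hx using fun m => exists_sub_eq_affine_mul_monomial c g w _ m rfl
  refine ⟨∑ m ∈ p.support, MvPolynomial.C (p.coeff m) * r m, ?_, fun x => ?_⟩
  · rcases eq_or_ne s 0 with rfl | hs
    · left
      refine Finset.sum_eq_zero fun m hm => ?_
      have h1 : m.degree ≤ 0 := (MvPolynomial.le_totalDegree hm).trans hp
      rcases hr m with h2 | h2
      · rw [h2, mul_zero]
      · omega
    · right
      refine lt_of_le_of_lt (MvPolynomial.totalDegree_finsetSum _ _) ?_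
      refine (Finset.sup_lt_iff (Nat.pos_of_ne_zero hs)).2 fun m hm => ?_
      have h1 : m.degree ≤ s := (MvPolynomial.le_totalDegree hm).trans hp
      refine lt_of_le_of_lt (MvPolynomial.totalDegree_mul _ _) ?_
      rw [MvPolynomial.totalDegree_C, zero_add]
      rcases hr m with h2 | h2
      · rw [h2]; simpa using Nat.pos_of_ne_zero hs
      · omega
  · have h1 : p = ∑ m ∈ p.support, MvPolynomial.C (p.coeff m) * MvPolynomial.monomial m 1 := by
      conv_lhs => rw [p.as_sum]
      exact Finset.sum_congr rfl fun m _ => by rw [MvPolynomial.C_mul_monomial, mul_one]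
    rw [h1]
    simp only [Poly.val_sum, Poly.val_mul, Poly.val_C]
    rw [← Finset.sum_sub_distrib, ← h1, Finset.mul_sum]
    exact Finset.sum_congr rfl fun m _ => by linear_combination p.coeff m * hx m x

/-- The gradient of `w` lies in `P_{s-1} ^ d`; for `s = 0` the moment condition is void, but `w` is
constant. -/
lemma integral_fderiv_eq_zero_of_moments {K : Finset (Space d)} {q : PolyField d} {s : ℕ}
    (hq : ∀ ψ : PolyField d, (∀ i, (ψ i).totalDegree < s) →
      ∫ x in hull K, inner ℝ (q.val x) (ψ.val x) = 0) {w : Poly d} (hw : w.totalDegree ≤ s) :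
    ∫ x in hull K, fderiv ℝ w.val x (q.val x) = 0 := by
  have h1 : ∀ x, fderiv ℝ w.val x (q.val x) =
      inner ℝ (q.val x) (PolyField.val (fun i => MvPolynomial.pderiv i w) x) := by
    intro x
    simp [Poly.fderiv_val, PiLp.inner_apply]
  simp_rw [h1]
  rcases eq_or_ne s 0 with rfl | hs
  · have h2 : (fun i => MvPolynomial.pderiv i w : PolyField d) = 0 := by
      ext1 i
      exact pderiv_eq_zero_of_totalDegree_eq_zero (Nat.le_zero.1 hw)
    have h3 : ∀ x, PolyField.val (0 : PolyField d) x = 0 := fun x => by ext i; simp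
    simp [h2, h3]
  · exact hq _ fun i => totalDegree_pderiv_lt hs hw

namespace Barycentric

variable {K : Finset (Space d)} (B : Barycentric K)

/-- The barycentric coordinate of a vertex as a polynomial. -/
def coordPoly (p : Space d) : Poly d := Poly.affine (B.coord p 0) (B.grad p)

@[simp] lemma val_coordPoly (p x : Space d) : (B.coordPoly p).val x = B.coord p x := by
  rw [coordPoly, Poly.val_affine, B.coord_eq p x 0, sub_zero]

variable [DecidableEq (Space d)]

/-- A polynomial vanishing on a facet is divisible by the barycentric coordinate of the opposite
vertex. -/
lemma exists_eq_coord_mul (hd : 1 ≤ d) (hcard : K.card = d + 1) {v : Space d} (hv : v ∈ K)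
    {s : ℕ} {p : Poly d} (hp : p.totalDegree ≤ s) (h0 : ∀ x ∈ hull (K.erase v), p.val x = 0) :
    ∃ r : Poly d, (r = 0 ∨ r.totalDegree < s) ∧ ∀ x, p.val x = B.coord v x * r.val x := by
  obtain ⟨c, hc⟩ := B.facetInterior_nonempty hd hcard hv
  -- Any `w` with `∇λ_v · w = 1` serves: then `x - λ_v(x) w` lies on the hyperplane of the facet.
  -- With this choice points near `c` are sent into the facet itself, where `p` vanishes, and a
  -- polynomial identity near `c` holds everywhere.
  set w : Space d := v - c
  have hw : inner ℝ (B.grad v) w = 1 := by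
    rw [← B.coord_sub, B.coord_self v hv, hc.1, sub_zero]
  have hco : ∀ x, B.coord v x = B.coord v 0 + inner ℝ (B.grad v) x := fun x => by
    rw [B.coord_eq v x 0, sub_zero]
  obtain ⟨r, hr, hx⟩ := exists_sub_eq_affine_mul (B.coord v 0) (B.grad v) w hp
  refine ⟨r, hr, ?_⟩
  have key : p = B.coordPoly v * r := by
    refine Poly.eq_of_val_eq (S := {x | ∀ q ∈ K.erase v, 0 < B.coord q (x - B.coord v x • w)})
      ?_ fun x hxS => ?_
    · refine ⟨c, mem_interior_iff_mem_nhds.2 ?_⟩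
      refine (Filter.eventually_all_finset _).2 fun q hq => ?_
      have hcont : Continuous fun x => B.coord q (x - B.coord v x • w) :=
        (B.continuous_coord q).comp
          (continuous_id.sub ((B.continuous_coord v).smul continuous_const))
      refine hcont.continuousAt.eventually_const_lt ?_
      simpa [hc.1] using hc.2 q hq
    · have h1 : x - B.coord v x • w ∈ hull (K.erase v) := by
        refine B.facetInterior_subset hv ⟨?_, hxS⟩
        rw [B.coord_eq v _ x]
        simp [inner_smul_right, hw]
      have h2 := hx x
      rw [← hco, h0 _ h1, sub_zero] at h2
      simp [h2]
  intro x
  conv_lhs => rw [key]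
  simp

include B in
/-- A field in `P_s ^ d + x P_s` is determined by its normal traces and by its moments against
`P_{s-1} ^ d`. -/
lemma localRT_eq_zero (hd : 1 ≤ d) (hcard : K.card = d + 1) {ν : Space d → Space d}
    (hν : ∀ p ∈ K, IsUnitNormal (K.erase p) (ν p)) {s : ℕ} {q : PolyField d}
    (hq : q ∈ localRT d s)
    (htr : ∀ p ∈ K, ∀ x ∈ hull (K.erase p), inner ℝ (q.val x) (ν p) = 0)
    (hmom : ∀ ψ : PolyField d, (∀ i, (ψ i).totalDegree < s) →
      ∫ x in hull K, inner ℝ (q.val x) (ψ.val x) = 0) : q = 0 := by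
  have hdiv : q.div = 0 := by
    refine Poly.eq_zero_of_val_eq_zero B.interior_nonempty fun x hx => ?_
    -- The test function is `div q`: its gradient is killed by the moments and the boundary terms by
    -- the traces, leaving `∫ (div q)² = 0`.
    have h1 := B.integral_divergence hd hcard hν (Poly.contDiff_val q.div) q
    have hc1 : Continuous fun x => fderiv ℝ q.div.val x (q.val x) :=
      ((Poly.contDiff_val q.div (n := 1)).continuous_fderiv one_ne_zero).clm_apply
        q.continuous_val
    have hc2 : Continuous fun x => q.div.val x * q.div.val x :=
      (Poly.continuous_val _).mul (Poly.continuous_val _)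
    rw [integral_add (hc1.continuousOn.integrableOn_compact (isCompact_hull K))
      (hc2.continuousOn.integrableOn_compact (isCompact_hull K)),
      integral_fderiv_eq_zero_of_moments hmom (totalDegree_div_le hq), zero_add,
      Finset.sum_eq_zero] at h1
    · exact mul_self_eq_zero.1
        (B.eqOn_zero_of_integral_hull_eq_zero hc2 (fun x _ => mul_self_nonneg _) h1 x hx)
    · intro p hp
      rw [setIntegral_congr_fun (measurableSet_hull _) (g := fun _ => (0 : ℝ))
        fun x hx => by simp [htr p hp x hx]]
      simp
  have hdeg := totalDegree_le_of_div_eq_zero hd hq hdiv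
  have hex : ∀ p ∈ K, ∃ r : Poly d, (r = 0 ∨ r.totalDegree < s) ∧
      ∀ x, inner ℝ (q.val x) (B.grad p) = B.coord p x * r.val x := by
    intro p hp
    obtain ⟨a, ha0, ha⟩ := B.exists_normal_eq hd hcard hp (hν p hp)
    have h1 : ∀ x ∈ hull (K.erase p), (q.dot (B.grad p)).val x = 0 := by
      intro x hx
      have h2 := htr p hp x hx
      rw [ha, inner_smul_right] at h2
      rw [PolyField.val_dot]
      exact (mul_eq_zero.1 h2).resolve_left ha0
    obtain ⟨r, hr, h3⟩ :=
      B.exists_eq_coord_mul hd hcard hp (PolyField.totalDegree_dot_le hdeg (B.grad p)) h1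
    exact ⟨r, hr, fun x => by rw [← h3, PolyField.val_dot]⟩
  choose! r hr hx using hex
  have hr0 : ∀ p ∈ K, r p = 0 := by
    rcases eq_or_ne s 0 with rfl | hs
    · exact fun p hp => (hr p hp).resolve_right (by omega)
    -- Since `q · ∇λ_p = λ_p r_p`, this field turns the moment into the integral of `∑ λ_p r_p² ≥
    -- 0`.
    let ψ : PolyField d := fun i => ∑ p ∈ K, r p * MvPolynomial.C (B.grad p i)
    have hψ : ∀ x, inner ℝ (q.val x) (ψ.val x) = ∑ p ∈ K, B.coord p x * (r p).val x ^ 2 := by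
      intro x
      have h1 : ψ.val x = ∑ p ∈ K, (r p).val x • B.grad p := by
        ext i
        simp [ψ]
      rw [h1, inner_sum]
      refine Finset.sum_congr rfl fun p hp => ?_
      rw [inner_smul_right, hx p hp]
      ring
    have h1 := hmom ψ fun i => by
      refine lt_of_le_of_lt (MvPolynomial.totalDegree_finsetSum _ _) ?_
      refine (Finset.sup_lt_iff (Nat.pos_of_ne_zero hs)).2 fun p hp => ?_
      refine lt_of_le_of_lt (MvPolynomial.totalDegree_mul _ _) ?_
      rw [MvPolynomial.totalDegree_C, add_zero]
      rcases hr p hp with h2 | h2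
      · rw [h2]; simpa using Nat.pos_of_ne_zero hs
      · exact h2
    simp_rw [hψ] at h1
    have hnn : ∀ x ∈ hull K, ∀ p ∈ K, 0 ≤ B.coord p x * (r p).val x ^ 2 := by
      intro x hx p hp
      rw [B.hull_eq] at hx
      exact mul_nonneg (hx p hp) (sq_nonneg _)
    have h2 := B.eqOn_zero_of_integral_hull_eq_zero
      (continuous_finsetSum _ fun p _ => (B.continuous_coord p).mul
        ((Poly.continuous_val (r p)).pow 2))
      (fun x hx => Finset.sum_nonneg (hnn x hx)) h1
    intro p hp
    refine Poly.eq_zero_of_val_eq_zero (S := interior (hull K))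
      (by rw [interior_interior]; exact B.interior_nonempty) fun x hx => ?_
    have h3 := (Finset.sum_eq_zero_iff_of_nonneg (hnn x (interior_subset hx))).1
      (h2 x (interior_subset hx)) p hp
    rw [B.interior_hull] at hx
    exact pow_eq_zero_iff two_ne_zero |>.1 ((mul_eq_zero.1 h3).resolve_left (hx p hp).ne')
  have hval : ∀ x, q.val x = 0 := by
    intro x
    rw [← B.sum_inner_grad_smul (q.val x)]
    refine Finset.sum_eq_zero fun p hp => ?_
    rw [real_inner_comm, hx p hp, hr0 p hp]
    simp
  ext1 i
  refine Poly.eq_zero_of_val_eq_zero B.interior_nonempty fun x _ => ?_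
  rw [← PolyField.val_apply, hval]
  rfl

end Barycentric

/-! ### Fields with prescribed traces and vanishing moments -/

namespace PolyField

@[simp] lemma val_smul (c : ℝ) (q : PolyField d) (x : Space d) :
    PolyField.val (c • q) x = c • q.val x := by
  ext i
  simp [MvPolynomial.smul_eq_C_mul]

lemma dot_add (q q' : PolyField d) (v : Space d) : dot (q + q') v = q.dot v + q'.dot v := by
  simp [dot, add_mul, Finset.sum_add_distrib]

lemma dot_smul (c : ℝ) (q : PolyField d) (v : Space d) :
    dot (c • q) v = MvPolynomial.C c * q.dot v := by
  simp [dot, MvPolynomial.smul_eq_C_mul, Finset.mul_sum, mul_assoc]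

/-- The `L²` pairing of polynomial vector fields on a simplex. -/
def pairing (K : Finset (Space d)) : PolyField d →ₗ[ℝ] PolyField d →ₗ[ℝ] ℝ :=
  have hint (q ψ : PolyField d) :
      IntegrableOn (fun x => inner ℝ (q.val x) (ψ.val x)) (hull K) :=
    (q.continuous_val.inner ψ.continuous_val).continuousOn.integrableOn_compact (isCompact_hull K)
  LinearMap.mk₂ ℝ (fun q ψ => ∫ x in hull K, inner ℝ (q.val x) (ψ.val x))
    (fun q q' ψ => by
      simp only [val_add, inner_add_left]
      exact integral_add (hint q ψ) (hint q' ψ))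
    (fun c q ψ => by
      simp only [val_smul, inner_smul_left]
      exact integral_const_mul _ _)
    (fun q ψ ψ' => by
      simp only [val_add, inner_add_right]
      exact integral_add (hint q ψ) (hint q ψ'))
    (fun c q ψ => by
      simp only [val_smul, inner_smul_right]
      exact integral_const_mul _ _)

lemma pairing_apply (K : Finset (Space d)) (q ψ : PolyField d) :
    pairing K q ψ = ∫ x in hull K, inner ℝ (q.val x) (ψ.val x) := rfl

/-- Vector fields whose components have degree at most `m`. -/
def degreeLE (d m : ℕ) : Submodule ℝ (PolyField d) :=
  Submodule.pi Set.univ fun _ => MvPolynomial.restrictTotalDegree (Fin d) ℝ m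

lemma mem_degreeLE {m : ℕ} {q : PolyField d} :
    q ∈ degreeLE d m ↔ ∀ i, (q i).totalDegree ≤ m := by
  simp [degreeLE, Submodule.mem_pi, MvPolynomial.mem_restrictTotalDegree]

instance (m : ℕ) : FiniteDimensional ℝ (degreeLE d m) := by
  let f : (Fin d → MvPolynomial.restrictTotalDegree (Fin d) ℝ m) →ₗ[ℝ] PolyField d :=
    LinearMap.pi fun i => (Submodule.subtype _).comp (LinearMap.proj i)
  have h : degreeLE d m = LinearMap.range f := by
    ext q
    rw [mem_degreeLE]
    constructor
    · intro hq
      exact ⟨fun i => ⟨q i, (MvPolynomial.mem_restrictTotalDegree _ _ _).2 (hq i)⟩, rfl⟩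
    · rintro ⟨g, rfl⟩ i
      exact (MvPolynomial.mem_restrictTotalDegree _ _ _).1 (g i).2
  rw [h]
  infer_instance

end PolyField

namespace Barycentric

variable {K : Finset (Space d)} (B : Barycentric K)

/-- The field `∑ λ_p (p - x) ((p - x) · ψ)`, whose normal traces vanish. -/
def bubble : PolyField d →ₗ[ℝ] PolyField d where
  -- By `∑ λ_p p = x` the bubble simplifies to `∑ λ_p (ψ · p) p - x (x · ψ)`, which displays the
  -- Raviart-Thomas form.
  toFun ψ i := ∑ p ∈ K, B.coordPoly p * ψ.dot p * MvPolynomial.C (p i) -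
    MvPolynomial.X i * ∑ j, MvPolynomial.X j * ψ j
  map_add' ψ ψ' := by
    ext1 i
    simp only [PolyField.dot_add, Pi.add_apply, add_mul, mul_add, Finset.sum_add_distrib]
    abel
  map_smul' c ψ := by
    ext1 i
    have h1 : ∀ p, B.coordPoly p * PolyField.dot (c • ψ) p * MvPolynomial.C (p i) =
        MvPolynomial.C c * (B.coordPoly p * ψ.dot p * MvPolynomial.C (p i)) := fun p => by
      rw [PolyField.dot_smul]; ring
    have h2 : ∀ j, MvPolynomial.X j * (c • ψ) j = MvPolynomial.C c * (MvPolynomial.X j * ψ j) :=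
      fun j => by rw [Pi.smul_apply, MvPolynomial.smul_eq_C_mul]; ring
    simp_rw [h1, h2, ← Finset.mul_sum]
    rw [RingHom.id_apply, Pi.smul_apply, MvPolynomial.smul_eq_C_mul]
    ring

lemma inner_val_bubble (ψ : PolyField d) (x v : Space d) :
    inner ℝ ((B.bubble ψ).val x) v =
      ∑ p ∈ K, B.coord p x * (inner ℝ (p - x) (ψ.val x) * inner ℝ (p - x) v) := by
  have h1 : (B.bubble ψ).val x =
      ∑ p ∈ K, (B.coord p x * inner ℝ (ψ.val x) p) • p - inner ℝ (ψ.val x) x • x := by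
    ext i
    simp only [bubble, LinearMap.coe_mk, AddHom.coe_mk, PolyField.val_apply, Poly.val_sub,
      Poly.val_sum, Poly.val_mul, val_coordPoly, PolyField.val_dot, Poly.val_C, Poly.val_X,
      PiLp.sub_apply, PiLp.smul_apply, smul_eq_mul, WithLp.ofLp_sum, Finset.sum_apply,
      PiLp.inner_apply]
    simp [mul_comm]
  have h2 : ∀ p, B.coord p x * (inner ℝ (p - x) (ψ.val x) * inner ℝ (p - x) v) =
      B.coord p x * inner ℝ (ψ.val x) p * inner ℝ p v
        - inner ℝ (ψ.val x) x * (B.coord p x * inner ℝ p v)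
        - inner ℝ x v * (B.coord p x * inner ℝ (ψ.val x) p)
        + inner ℝ (ψ.val x) x * inner ℝ x v * B.coord p x := by
    intro p
    rw [inner_sub_left, inner_sub_left, real_inner_comm (ψ.val x) p, real_inner_comm (ψ.val x) x]
    ring
  have h3 : ∑ p ∈ K, B.coord p x * inner ℝ p v = inner ℝ x v :=
    B.sum_coord_mul (g := fun y => inner ℝ y v) (c := 0) (v := v)
      (fun y => by rw [zero_add, real_inner_comm]) x
  have h4 : ∑ p ∈ K, B.coord p x * inner ℝ (ψ.val x) p = inner ℝ (ψ.val x) x :=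
    B.sum_coord_mul (g := fun y => inner ℝ (ψ.val x) y) (c := 0) (v := ψ.val x)
      (fun y => by rw [zero_add]) x
  simp_rw [h2, Finset.sum_add_distrib, Finset.sum_sub_distrib, ← Finset.mul_sum, h3, h4,
    B.sum_coord, h1, inner_sub_left, sum_inner, real_inner_smul_left]
  ring

lemma bubble_mem_localRT {m : ℕ} {ψ : PolyField d} (hψ : ψ ∈ PolyField.degreeLE d m) :
    B.bubble ψ ∈ localRT d (m + 1) := by
  rw [PolyField.mem_degreeLE] at hψ
  refine ⟨fun i => ∑ p ∈ K, B.coordPoly p * ψ.dot p * MvPolynomial.C (p i), fun i => ?_,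
    - ∑ j, MvPolynomial.X j * ψ j, ?_, fun i => ?_⟩
  · refine (MvPolynomial.totalDegree_finsetSum _ _).trans (Finset.sup_le fun p _ => ?_)
    refine (MvPolynomial.totalDegree_mul _ _).trans ?_
    rw [MvPolynomial.totalDegree_C, add_zero]
    refine (MvPolynomial.totalDegree_mul _ _).trans ?_
    have h1 := PolyField.totalDegree_dot_le hψ p
    have h2 : (B.coordPoly p).totalDegree ≤ 1 := Poly.totalDegree_affine _ _
    omega
  · rw [MvPolynomial.totalDegree_neg]
    refine (MvPolynomial.totalDegree_finsetSum _ _).trans (Finset.sup_le fun j _ => ?_)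
    refine (MvPolynomial.totalDegree_mul _ _).trans ?_
    rw [MvPolynomial.totalDegree_X]
    have := hψ j
    omega
  · simp only [bubble, LinearMap.coe_mk, AddHom.coe_mk]
    ring

lemma inner_edge_eq_zero [DecidableEq (Space d)] {v ν : Space d} {a : ℝ} (hv : v ∈ K)
    (ha : ν = a • B.grad v) {p x : Space d} (hp : p ∈ K) (hpv : p ≠ v)
    (hx : x ∈ hull (K.erase v)) : inner ℝ (p - x) ν = 0 := by
  rw [B.hull_erase hv] at hx
  rw [ha, inner_smul_right, real_inner_comm, ← B.coord_sub, B.coord_ne v hv p hp hpv.symm, hx.2]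
  simp

/-- On the facet opposite to `v` the term of `v` carries the factor `λ_v = 0`, and for the other
vertices `p - x` is tangential. -/
lemma inner_bubble_normal [DecidableEq (Space d)] {v ν : Space d} {a : ℝ} (hv : v ∈ K)
    (ha : ν = a • B.grad v) (ψ : PolyField d) {x : Space d} (hx : x ∈ hull (K.erase v)) :
    inner ℝ ((B.bubble ψ).val x) ν = 0 := by
  rw [inner_val_bubble]
  refine Finset.sum_eq_zero fun p hp => ?_
  rcases eq_or_ne p v with rfl | hpv
  · rw [B.hull_erase hv] at hx
    rw [hx.2, zero_mul]
  · rw [B.inner_edge_eq_zero hv ha hp hpv hx, mul_zero, mul_zero]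

/-- The integrand is `∑ λ_p ((p - x) · ψ)²`. At an interior point all weights are positive, so
`ψ(x)` is orthogonal to every `p - x`, and these vectors span. -/
lemma eq_zero_of_pairing_bubble_eq_zero {ψ : PolyField d}
    (h : PolyField.pairing K (B.bubble ψ) ψ = 0) : ψ = 0 := by
  rw [PolyField.pairing_apply] at h
  have hnn : ∀ x ∈ hull K, ∀ p ∈ K, 0 ≤
      B.coord p x * (inner ℝ (p - x) (ψ.val x) * inner ℝ (p - x) (ψ.val x)) := by
    intro x hx p hp
    rw [B.hull_eq] at hx
    exact mul_nonneg (hx p hp) (mul_self_nonneg _)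
  have h1 := B.eqOn_zero_of_integral_hull_eq_zero
    ((B.bubble ψ).continuous_val.inner ψ.continuous_val)
    (fun x hx => by rw [inner_val_bubble]; exact Finset.sum_nonneg (hnn x hx)) h
  have hval : ∀ x ∈ interior (hull K), ψ.val x = 0 := by
    intro x hx
    have hx' := interior_subset hx
    have h2 := h1 x hx'
    rw [inner_val_bubble, Finset.sum_eq_zero_iff_of_nonneg (hnn x hx')] at h2
    rw [B.interior_hull] at hx
    have h3 : ∀ p ∈ K, inner ℝ (p - x) (ψ.val x) = 0 := fun p hp =>
      mul_self_eq_zero.1 ((mul_eq_zero.1 (h2 p hp)).resolve_left (hx p hp).ne')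
    rw [← inner_self_eq_zero (𝕜 := ℝ)]
    conv_lhs => arg 2; rw [← B.sum_inner_grad_smul (ψ.val x)]
    have h4 : ∀ p ∈ K, inner ℝ (inner ℝ (B.grad p) (ψ.val x) • p) (ψ.val x) =
        inner ℝ (B.grad p) (ψ.val x) * inner ℝ x (ψ.val x) := by
      intro p hp
      have h5 := h3 p hp
      rw [inner_sub_left, sub_eq_zero] at h5
      rw [real_inner_smul_left, h5]
    rw [sum_inner, Finset.sum_congr rfl h4, ← Finset.sum_mul, ← sum_inner, B.sum_grad,
      inner_zero_left, zero_mul]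
  ext1 i
  refine Poly.eq_zero_of_val_eq_zero (S := interior (hull K))
    (by rw [interior_interior]; exact B.interior_nonempty) fun x hx => ?_
  rw [← PolyField.val_apply, hval x hx]
  rfl

/-- Moments against polynomial fields can be removed without changing the normal traces. -/
lemma exists_bubble_pairing_eq (m : ℕ) (q : PolyField d) :
    ∃ ψ ∈ PolyField.degreeLE d m, ∀ ψ' ∈ PolyField.degreeLE d m,
      PolyField.pairing K (B.bubble ψ) ψ' = PolyField.pairing K q ψ' := by
  let W := PolyField.degreeLE d m
  let R : PolyField d →ₗ[ℝ] Module.Dual ℝ W := (PolyField.pairing K).compl₂ W.subtype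
  -- A positive definite pairing makes this map injective, hence onto: a finite-dimensional space
  -- and its dual have equal dimension.
  let Φ : W →ₗ[ℝ] Module.Dual ℝ W := (R.comp B.bubble).comp W.subtype
  have hinj : Function.Injective Φ := by
    rw [← LinearMap.ker_eq_bot, LinearMap.ker_eq_bot']
    intro ψ hψ
    have h1 : PolyField.pairing K (B.bubble ψ) ψ = 0 := LinearMap.congr_fun hψ ψ
    exact Subtype.ext (B.eq_zero_of_pairing_bubble_eq_zero h1)
  have hsurj : Function.Surjective Φ :=
    (LinearMap.injective_iff_surjective_of_finrank_eq_finrank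
      Subspace.dual_finrank_eq.symm).1 hinj
  obtain ⟨ψ, hψ⟩ := hsurj (R q)
  exact ⟨ψ, ψ.2, fun ψ' hψ' => LinearMap.congr_fun hψ ⟨ψ', hψ'⟩⟩

include B in
/-- There are fields in `P_s ^ d + x P_s` with prescribed normal traces in `P_s` and vanishing
moments against `P_{s-1} ^ d`. -/
lemma exists_localRT [DecidableEq (Space d)] (hd : 1 ≤ d) (hcard : K.card = d + 1)
    {ν : Space d → Space d}
    (hν : ∀ p ∈ K, IsUnitNormal (K.erase p) (ν p)) {s : ℕ} (g : Space d → Poly d)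
    (hg : ∀ p ∈ K, (g p).totalDegree ≤ s) :
    ∃ q ∈ localRT d s,
      (∀ p ∈ K, ∀ x ∈ hull (K.erase p), inner ℝ (q.val x) (ν p) = (g p).val x) ∧
      ∀ ψ : PolyField d, (∀ i, (ψ i).totalDegree < s) →
        ∫ x in hull K, inner ℝ (q.val x) (ψ.val x) = 0 := by
  have hex : ∀ p ∈ K, ∃ a : ℝ, a ≠ 0 ∧ ν p = a • B.grad p :=
    fun p hp => B.exists_normal_eq hd hcard hp (hν p hp)
  choose! a ha0 ha using hex
  -- On the facet opposite to `p`, `(r - x) · ν_p` is `0` for a vertex `r ≠ p` and `a_p` for `r =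
  -- p`, whence the factor `(a p)⁻¹`.
  let q₀ : PolyField d := fun i =>
    ∑ p ∈ K, (MvPolynomial.C (p i) - MvPolynomial.X i) * (MvPolynomial.C (a p)⁻¹ * g p)
  have hq₀ : q₀ ∈ localRT d s := by
    refine ⟨fun i => ∑ p ∈ K, MvPolynomial.C (p i) * (MvPolynomial.C (a p)⁻¹ * g p), fun i => ?_,
      - ∑ p ∈ K, MvPolynomial.C (a p)⁻¹ * g p, ?_, fun i => ?_⟩
    · refine (MvPolynomial.totalDegree_finsetSum _ _).trans (Finset.sup_le fun p hp => ?_)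
      refine (MvPolynomial.totalDegree_mul _ _).trans ?_
      rw [MvPolynomial.totalDegree_C, zero_add]
      refine (MvPolynomial.totalDegree_mul _ _).trans ?_
      rw [MvPolynomial.totalDegree_C, zero_add]
      exact hg p hp
    · rw [MvPolynomial.totalDegree_neg]
      refine (MvPolynomial.totalDegree_finsetSum _ _).trans (Finset.sup_le fun p hp => ?_)
      refine (MvPolynomial.totalDegree_mul _ _).trans ?_
      rw [MvPolynomial.totalDegree_C, zero_add]
      exact hg p hp
    · simp only [q₀, sub_mul, Finset.sum_sub_distrib, Finset.mul_sum, mul_neg]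
      ring
  have htr₀ : ∀ p ∈ K, ∀ x ∈ hull (K.erase p), inner ℝ (q₀.val x) (ν p) = (g p).val x := by
    intro p hp x hx
    have h1 : q₀.val x = ∑ r ∈ K, ((a r)⁻¹ * (g r).val x) • (r - x) := by
      ext i
      simp [q₀, mul_comm]
    rw [h1, sum_inner, Finset.sum_eq_single_of_mem p hp]
    · rw [real_inner_smul_left, ha p hp, inner_smul_right, real_inner_comm, ← B.coord_sub,
        B.coord_self p hp]
      rw [B.hull_erase hp] at hx
      rw [hx.2]
      field_simp [ha0 p hp]
      ring
    · intro r hr hrp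
      rw [real_inner_smul_left, B.inner_edge_eq_zero hp (ha p hp) hr hrp hx, mul_zero]
  rcases s with _ | m
  · exact ⟨q₀, hq₀, htr₀, fun ψ hψ => absurd (hψ ⟨0, hd⟩) (by omega)⟩
  · obtain ⟨ψ, hψ, h⟩ := B.exists_bubble_pairing_eq m q₀
    refine ⟨q₀ - B.bubble ψ, localRT_sub hq₀ (B.bubble_mem_localRT hψ), fun p hp x hx => ?_,
      fun ψ' hψ' => ?_⟩
    · rw [PolyField.val_sub, inner_sub_left, htr₀ p hp x hx,
        B.inner_bubble_normal hp (ha p hp) ψ hx, sub_zero]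
    · rw [← PolyField.pairing_apply, map_sub, LinearMap.sub_apply,
        h ψ' (PolyField.mem_degreeLE.2 fun i => Nat.lt_succ_iff.1 (hψ' i)), sub_self]

end Barycentric

/-! ### Geometry of triangulations -/

namespace Barycentric

variable {K : Finset (Space d)} (B : Barycentric K) [DecidableEq (Space d)]

/-- Near a relative interior point of a facet the other coordinates stay positive, so the simplex is
locally a half-space. -/
lemma eventually_mem_hull_iff {p x : Space d} (hp : p ∈ K) (hx : x ∈ B.facetInterior p) :
    ∀ᶠ y in nhds x, y ∈ hull K ↔ 0 ≤ B.coord p y := by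
  have h1 : ∀ᶠ y in nhds x, ∀ q ∈ K.erase p, 0 < B.coord q y := by
    rw [Filter.eventually_all_finset]
    exact fun q hq => (B.continuous_coord q).continuousAt.eventually_const_lt (hx.2 q hq)
  filter_upwards [h1] with y hy
  rw [B.hull_eq]
  refine ⟨fun h => h p hp, fun h q hq => ?_⟩
  rcases eq_or_ne q p with rfl | hqp
  · exact h
  · exact (hy q (Finset.mem_erase.2 ⟨hqp, hq⟩)).le

/-- Interpolate the affine function `B'.coord r` at the vertices of `K`; on the common facet only
shared vertices contribute. -/
lemma coord_eq_coord {K' : Finset (Space d)} (B' : Barycentric K') {p p' x : Space d}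
    (hp : p ∈ K) (hF : K.erase p = K'.erase p') (hx : B.coord p x = 0) {r : Space d}
    (hr : r ∈ K.erase p) : B'.coord r x = B.coord r x := by
  have h1 := B.sum_coord_mul (g := B'.coord r) (c := B'.coord r 0) (v := B'.grad r)
    (fun y => by rw [B'.coord_eq r y 0, sub_zero]) x
  have hsub : ∀ q ∈ K.erase p, q ∈ K' := fun q hq => by
    rw [hF] at hq; exact Finset.mem_of_mem_erase hq
  rw [← h1, ← Finset.add_sum_erase K _ hp, hx, zero_mul, zero_add,
    Finset.sum_eq_single_of_mem r hr, B'.coord_self r (hsub r hr), mul_one]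
  intro q hq hqr
  rw [B'.coord_ne r (hsub r hr) q (hsub q hq) hqr.symm, mul_zero]

lemma facetInterior_eq {K' : Finset (Space d)} (B' : Barycentric K') {p p' x : Space d}
    (hp : p ∈ K) (hp' : p' ∈ K') (hF : K.erase p = K'.erase p') (hx : x ∈ B.facetInterior p) :
    x ∈ B'.facetInterior p' := by
  refine ⟨?_, fun q hq => ?_⟩
  · have := B.facetInterior_subset hp hx
    rw [hF, B'.hull_erase hp'] at this
    exact this.2
  · rw [← hF] at hq
    rw [B.coord_eq_coord B' hp hF hx.1 hq]
    exact hx.2 q hq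

lemma grad_ne_zero (hd : 1 ≤ d) (hcard : K.card = d + 1) {p : Space d} (hp : p ∈ K) :
    B.grad p ≠ 0 := by
  obtain ⟨c, hc⟩ := B.facetInterior_nonempty hd hcard hp
  intro h
  have h1 := B.coord_eq p p c
  rw [h, inner_zero_left, B.coord_self p hp, hc.1] at h1
  norm_num at h1

end Barycentric

namespace Triangulation

variable {Ω : Set (Space d)} (T : Triangulation d Ω)

lemma mem_elements {K : Finset (Space d)} : K ∈ T.elements ↔ K ∈ T.faces ∧ K.card = d + 1 := by
  simp [elements]

lemma isSimplex (K : T.elements) : IsSimplex K.1 :=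
  ⟨T.indep (T.mem_elements.1 K.2).1, (T.mem_elements.1 K.2).2⟩

/-- A choice of barycentric coordinates on each element. -/
def bary (K : T.elements) : Barycentric K.1 := (T.isSimplex K).nonempty_barycentric.some

lemma mem_elementsAt {F : Finset (Space d)} {K : T.elements} : K ∈ T.elementsAt F ↔ F ⊆ K.1 := by
  simp [elementsAt]

lemma mem_facets {F : Finset (Space d)} :
    F ∈ T.facets ↔ F.card = d ∧ ∃ K : T.elements, K ∈ T.elementsAt F := by
  simp only [facets, Finset.mem_biUnion, Finset.mem_powersetCard, mem_elementsAt]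
  constructor
  · rintro ⟨K, hK, hFK, hc⟩
    exact ⟨hc, ⟨K, hK⟩, hFK⟩
  · rintro ⟨hc, K, hFK⟩
    exact ⟨K.1, K.2, hFK, hc⟩

lemma facet_mem_faces (hd : 1 ≤ d) {F : Finset (Space d)} (hF : F ∈ T.facets) : F ∈ T.faces := by
  obtain ⟨hc, K, hK⟩ := T.mem_facets.1 hF
  exact T.down_closed (T.mem_elements.1 K.2).1 (T.mem_elementsAt.1 hK)
    (Finset.card_pos.1 (by omega))

lemma closure_eq : closure Ω = ⋃ K : T.elements, hull K.1 := by
  rw [← T.space_eq]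
  ext x
  simp only [Geometry.SimplicialComplex.mem_space_iff, Set.mem_iUnion]
  constructor
  · rintro ⟨s, hs, hx⟩
    obtain ⟨K, hK, hKc, hsK⟩ := T.pure s hs
    exact ⟨⟨K, T.mem_elements.2 ⟨hK, hKc⟩⟩, convexHull_mono (by exact_mod_cast hsK) hx⟩
  · rintro ⟨K, hx⟩
    exact ⟨K.1, (T.mem_elements.1 K.2).1, hx⟩

include T in
lemma isCompact_closure : IsCompact (closure Ω) := by
  rw [T.closure_eq]
  exact isCompact_iUnion fun K => isCompact_hull K.1

lemma isOpen_domain {Ω : Set (Space d)} (hΩ : interior (closure Ω) = Ω) : IsOpen Ω :=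
  hΩ ▸ isOpen_interior

lemma interior_hull_subset (hΩ : interior (closure Ω) = Ω) (K : T.elements) :
    interior (hull K.1) ⊆ Ω := by
  refine (interior_mono ?_).trans hΩ.subset
  rw [T.closure_eq]
  exact Set.subset_iUnion (fun K : T.elements => hull K.1) K

variable [DecidableEq (Space d)]

lemma exists_eq_erase {F : Finset (Space d)} (hF : F ∈ T.facets) {K : T.elements}
    (hK : K ∈ T.elementsAt F) : ∃ p ∈ K.1, F = K.1.erase p := by
  have hsub := T.mem_elementsAt.1 hK
  have h1 : (K.1 \ F).card = 1 := by
    rw [Finset.card_sdiff_of_subset hsub, (T.isSimplex K).card_eq, (T.mem_facets.1 hF).1]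
    omega
  obtain ⟨p, hp⟩ := Finset.card_eq_one.1 h1
  have hpK : p ∈ K.1 \ F := by rw [hp]; simp
  refine ⟨p, (Finset.mem_sdiff.1 hpK).1, ?_⟩
  rw [Finset.erase_eq, ← hp, Finset.sdiff_sdiff_eq_self hsub]

lemma erase_mem_facets (K : T.elements) {p : Space d} (hp : p ∈ K.1) : K.1.erase p ∈ T.facets := by
  refine T.mem_facets.2 ⟨?_, K, T.mem_elementsAt.2 (Finset.erase_subset _ _)⟩
  rw [Finset.card_erase_of_mem hp, (T.isSimplex K).card_eq]
  rfl

lemma mem_elementsAt_erase (K : T.elements) (p : Space d) : K ∈ T.elementsAt (K.1.erase p) :=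
  T.mem_elementsAt.2 (Finset.erase_subset _ _)

/-- If a point of an element lies in a face that misses a vertex of the element, its coordinate
for that vertex vanishes. -/
lemma coord_eq_zero_of_mem_face (K : T.elements) (B : Barycentric K.1) {s : Finset (Space d)}
    (hs : s ∈ T.faces) {x q : Space d} (hxK : x ∈ hull K.1) (hxs : x ∈ hull s) (hq : q ∈ K.1)
    (hqs : q ∉ s) : B.coord q x = 0 := by
  have h1 := T.inter_subset_convexHull (T.mem_elements.1 K.2).1 hs ⟨hxK, hxs⟩
  have h2 : x ∈ hull (K.1.erase q) := by
    refine convexHull_mono (fun y hy => ?_) h1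
    refine Finset.mem_coe.2 (Finset.mem_erase.2 ⟨?_, hy.1⟩)
    rintro rfl
    exact hqs hy.2
  rw [B.hull_erase hq] at h2
  exact h2.2

/-- Conformity: a face through a relative interior point of a facet contains the whole facet. -/
lemma erase_subset_of_mem_facetInterior (K : T.elements) (B : Barycentric K.1)
    {s : Finset (Space d)} (hs : s ∈ T.faces) {x p : Space d} (hp : p ∈ K.1)
    (hx : x ∈ B.facetInterior p) (hxs : x ∈ hull s) : K.1.erase p ⊆ s := by
  intro q hq
  by_contra hqs
  have hxK : x ∈ hull K.1 := by
    have := B.facetInterior_subset hp hx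
    rw [B.hull_erase hp] at this
    exact this.1
  exact (hx.2 q hq).ne' (T.coord_eq_zero_of_mem_face K B hs hxK hxs
    (Finset.mem_of_mem_erase hq) hqs)

/-- Two elements lie on opposite sides of a common facet. -/
lemma grad_opposite (hd : 1 ≤ d) {K K' : T.elements} (hne : K ≠ K') (B : Barycentric K.1)
    (B' : Barycentric K'.1) {p p' : Space d} (hp : p ∈ K.1) (hp' : p' ∈ K'.1)
    (hF : K.1.erase p = K'.1.erase p') {ν : Space d} {a a' : ℝ} (ha0 : a ≠ 0) (ha0' : a' ≠ 0)
    (ha : ν = a • B.grad p) (ha' : ν = a' • B'.grad p') : a * a' < 0 := by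
  by_contra hpos
  have hpos' : 0 < a * a' := lt_of_le_of_ne (not_lt.1 hpos) (mul_ne_zero ha0 ha0').symm
  obtain ⟨x, hx⟩ := B.facetInterior_nonempty hd (T.isSimplex K).card_eq hp
  have hx' := B.facetInterior_eq B' hp hp' hF hx
  have hpK' : p ∉ K'.1 := by
    intro hpK'
    have h1 : K.1 ⊆ K'.1 := by
      intro q hq
      rcases eq_or_ne q p with rfl | hqp
      · exact hpK'
      · have : q ∈ K.1.erase p := Finset.mem_erase.2 ⟨hqp, hq⟩
        rw [hF] at this
        exact Finset.mem_of_mem_erase this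
    refine hne (Subtype.ext (Finset.eq_of_subset_of_card_le h1 ?_))
    rw [(T.isSimplex K).card_eq, (T.isSimplex K').card_eq]
  have hg : 0 < inner ℝ (B.grad p) (B.grad p) :=
    real_inner_self_pos.2 (B.grad_ne_zero hd (T.isSimplex K).card_eq hp)
  have hgrad' : B'.grad p' = (a / a') • B.grad p := by
    have h1 : a' • B'.grad p' = a • B.grad p := ha'.symm.trans ha
    rw [div_eq_inv_mul, mul_smul, ← h1, smul_smul, inv_mul_cancel₀ ha0', one_smul]
  have hg' : 0 < inner ℝ (B'.grad p') (B.grad p) := by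
    rw [hgrad', real_inner_smul_left]
    refine mul_pos ?_ hg
    have h2 : a / a' = a * a' * (a'⁻¹ * a'⁻¹) := by field_simp
    rw [h2]
    exact mul_pos hpos' (mul_self_pos.2 (inv_ne_zero ha0'))
  -- If both elements lay on the same side, a small step from `x` along `∇λ_p` would enter both.
  -- Conformity then forces `λ_p = 0` there, although `λ_p` has grown.
  have hlim : Filter.Tendsto (fun t : ℝ => x + t • B.grad p) (nhdsWithin 0 (Set.Ioi 0))
      (nhds x) := by
    have : Continuous fun t : ℝ => x + t • B.grad p := by fun_prop
    simpa using (this.tendsto 0).mono_left nhdsWithin_le_nhds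
  have hev := (hlim.eventually (B.eventually_mem_hull_iff hp hx)).and
    ((hlim.eventually (B'.eventually_mem_hull_iff hp' hx')).and self_mem_nhdsWithin)
  obtain ⟨t, h1, h2, ht⟩ := hev.exists
  have ht' : 0 < t := ht
  have hc : B.coord p (x + t • B.grad p) = t * inner ℝ (B.grad p) (B.grad p) := by
    rw [B.coord_eq p _ x, hx.1, add_sub_cancel_left, inner_smul_right, zero_add]
  have hc' : B'.coord p' (x + t • B.grad p) = t * inner ℝ (B'.grad p') (B.grad p) := by
    rw [B'.coord_eq p' _ x, hx'.1, add_sub_cancel_left, inner_smul_right, zero_add]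
  have h3 := T.coord_eq_zero_of_mem_face K B (T.mem_elements.1 K'.2).1
    (h1.2 (by rw [hc]; positivity)) (h2.2 (by rw [hc']; positivity)) hp hpK'
  rw [hc] at h3
  exact (mul_pos ht' hg).ne' h3

/-- An interior facet belongs to exactly two elements, which lie on opposite sides of it. -/
lemma exists_pair_of_notMem_boundary (hd : 1 ≤ d) {F : Finset (Space d)} (hF : F ∈ T.facets)
    (hb : F ∉ T.boundaryFacets) {ν : Space d} (hν : IsUnitNormal F ν) :
    ∃ K K' : T.elements, K ≠ K' ∧ T.elementsAt F = {K, K'} ∧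
      signOf K.1 F ν + signOf K'.1 F ν = 0 := by
  have hb' : (T.elementsAt F).card ≠ 1 := fun h =>
    hb (by simp only [boundaryFacets, Finset.mem_filter]; exact ⟨hF, h⟩)
  obtain ⟨hc, K, hK⟩ := T.mem_facets.1 hF
  have hpos : 0 < (T.elementsAt F).card := Finset.card_pos.2 ⟨K, hK⟩
  obtain ⟨K', hK', hne⟩ := Finset.exists_mem_ne (by omega : 1 < (T.elementsAt F).card) K
  have key : ∀ L ∈ T.elementsAt F, ∃ p ∈ L.1, F = L.1.erase p ∧
      ∃ a : ℝ, a ≠ 0 ∧ ν = a • (T.bary L).grad p ∧ signOf L.1 F ν * a = -|a| := by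
    intro L hL
    obtain ⟨p, hp, hFp⟩ := T.exists_eq_erase hF hL
    subst hFp
    obtain ⟨a, ha0, ha⟩ := (T.bary L).exists_normal_eq hd (T.isSimplex L).card_eq hp hν
    exact ⟨p, hp, rfl, a, ha0, ha, (T.bary L).signOf_mul hd (T.isSimplex L).card_eq hp hν ha⟩
  obtain ⟨p, hp, hFp, a, ha0, ha, hs⟩ := key K hK
  obtain ⟨p', hp', hFp', a', ha0', ha', hs'⟩ := key K' hK'
  have hopp := T.grad_opposite hd hne.symm (T.bary K) (T.bary K') hp hp' (hFp.symm.trans hFp')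
    ha0 ha0' ha ha'
  refine ⟨K, K', hne.symm, ?_, ?_⟩
  · ext L
    simp only [Finset.mem_insert, Finset.mem_singleton]
    constructor
    · intro hL
      -- Of three nonzero coefficients two have the same sign, so a third element cannot be opposite
      -- to both.
      by_contra! hLne
      obtain ⟨r, hr, hFr, b, hb0, hb, -⟩ := key L hL
      have h1 := T.grad_opposite hd hLne.1 (T.bary L) (T.bary K) hr hp (hFr.symm.trans hFp)
        hb0 ha0 hb ha
      have h2 := T.grad_opposite hd hLne.2 (T.bary L) (T.bary K') hr hp' (hFr.symm.trans hFp')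
        hb0 ha0' hb ha'
      have h3 := mul_pos_of_neg_of_neg h1 h2
      have h4 : b * a * (b * a') = b ^ 2 * (a * a') := by ring
      rw [h4] at h3
      nlinarith [sq_nonneg b]
    · rintro (rfl | rfl)
      · exact hK
      · exact hK'
  · rcases lt_or_gt_of_ne ha0 with h | h
    · have h' : 0 < a' := by by_contra hn; nlinarith
      rw [abs_of_neg h, neg_neg] at hs
      rw [abs_of_pos h'] at hs'
      have e1 : signOf K.1 F ν = 1 := mul_right_cancel₀ ha0 (by rw [hs, one_mul])
      have e2 : signOf K'.1 F ν = -1 := mul_right_cancel₀ ha0' (by rw [hs', neg_one_mul])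
      rw [e1, e2]; norm_num
    · have h' : a' < 0 := by by_contra hn; nlinarith
      rw [abs_of_neg h', neg_neg] at hs'
      rw [abs_of_pos h] at hs
      have e1 : signOf K.1 F ν = -1 := mul_right_cancel₀ ha0 (by rw [hs, neg_one_mul])
      have e2 : signOf K'.1 F ν = 1 := mul_right_cancel₀ ha0' (by rw [hs', one_mul])
      rw [e1, e2]; norm_num

/-- Boundary facets do not meet the domain. -/
lemma disjoint_hull_of_mem_boundary (hd : 1 ≤ d) (hΩ : interior (closure Ω) = Ω)
    {F : Finset (Space d)} (hF : F ∈ T.boundaryFacets) : Disjoint (hull F) Ω := by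
  simp only [boundaryFacets, Finset.mem_filter] at hF
  obtain ⟨hF, hone⟩ := hF
  obtain ⟨K, hK⟩ := Finset.card_eq_one.1 hone
  have hKF : K ∈ T.elementsAt F := by rw [hK]; simp
  obtain ⟨p, hp, rfl⟩ := T.exists_eq_erase hF hKF
  set B := T.bary K
  rw [Set.disjoint_left]
  intro y hy hyΩ
  obtain ⟨x, hxΩ, hx⟩ := mem_closure_iff.1
    (B.hull_erase_subset_closure hd (T.isSimplex K).card_eq hp hy) Ω
    (isOpen_domain hΩ) hyΩ
  -- Near `x` only `K` is present. If `x` were in `Ω`, then `λ_p ≥ 0` on a neighbourhood, and a step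
  -- against `∇λ_p` contradicts this.
  have h1 : ∀ᶠ y in nhds x, ∀ L : T.elements, y ∈ hull L.1 → L = K := by
    rw [Filter.eventually_all]
    intro L
    by_cases hxL : x ∈ hull L.1
    · have h2 := T.erase_subset_of_mem_facetInterior K B (T.mem_elements.1 L.2).1 hp hx hxL
      have h3 : L ∈ T.elementsAt (K.1.erase p) := T.mem_elementsAt.2 h2
      rw [hK, Finset.mem_singleton] at h3
      exact Filter.Eventually.of_forall fun _ _ => h3
    · filter_upwards [(isCompact_hull L.1).isClosed.isOpen_compl.mem_nhds hxL] with y hy hyL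
      exact absurd hyL hy
  have h2 : ∀ᶠ y in nhds x, 0 ≤ B.coord p y := by
    filter_upwards [h1, (isOpen_domain hΩ).mem_nhds hxΩ, B.eventually_mem_hull_iff hp hx]
      with y h3 h4 h5
    have h6 := subset_closure h4
    rw [T.closure_eq, Set.mem_iUnion] at h6
    obtain ⟨L, hL⟩ := h6
    rw [h3 L hL] at hL
    exact h5.1 hL
  have hlim : Filter.Tendsto (fun t : ℝ => x + t • B.grad p) (nhdsWithin 0 (Set.Iio 0))
      (nhds x) := by
    have : Continuous fun t : ℝ => x + t • B.grad p := by fun_prop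
    simpa using (this.tendsto 0).mono_left nhdsWithin_le_nhds
  obtain ⟨t, h3, ht⟩ := ((hlim.eventually h2).and self_mem_nhdsWithin).exists
  have ht' : t < 0 := ht
  rw [B.coord_eq p _ x, hx.1, add_sub_cancel_left, inner_smul_right, zero_add] at h3
  have hg : 0 < inner ℝ (B.grad p) (B.grad p) :=
    real_inner_self_pos.2 (B.grad_ne_zero hd (T.isSimplex K).card_eq hp)
  nlinarith

/-- The relative interior of an interior facet is contained in the domain. -/
lemma facetInterior_subset_domain (hd : 1 ≤ d) (hΩ : interior (closure Ω) = Ω) {K : T.elements}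
    (B : Barycentric K.1) {p : Space d} (hp : p ∈ K.1) (hb : K.1.erase p ∉ T.boundaryFacets)
    {ν : Space d} (hν : IsUnitNormal (K.1.erase p) ν) : B.facetInterior p ⊆ Ω := by
  intro x hx
  have hF := T.erase_mem_facets K hp
  have hKF := T.mem_elementsAt_erase K p
  obtain ⟨L, L', hne, hLL', -⟩ := T.exists_pair_of_notMem_boundary hd hF hb hν
  obtain ⟨K', hK'F, hne'⟩ : ∃ K' ∈ T.elementsAt (K.1.erase p), K ≠ K' := by
    rw [hLL'] at hKF ⊢
    simp only [Finset.mem_insert, Finset.mem_singleton] at hKF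
    rcases hKF with rfl | rfl
    · exact ⟨L', by simp, hne⟩
    · exact ⟨L, by simp, hne.symm⟩
  obtain ⟨p', hp', hFp'⟩ := T.exists_eq_erase hF hK'F
  set B' := T.bary K'
  have hx' := B.facetInterior_eq B' hp hp' hFp' hx
  obtain ⟨a, ha0, ha⟩ := B.exists_normal_eq hd (T.isSimplex K).card_eq hp hν
  obtain ⟨a', ha0', ha'⟩ := B'.exists_normal_eq hd (T.isSimplex K').card_eq hp' (hFp' ▸ hν)
  have hopp := T.grad_opposite hd hne' B B' hp hp' hFp' ha0 ha0' ha ha'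
  rw [← hΩ]
  refine mem_interior_iff_mem_nhds.2 ?_
  filter_upwards [B.eventually_mem_hull_iff hp hx, B'.eventually_mem_hull_iff hp' hx'] with y h1 h2
  rw [T.closure_eq]
  -- Both sides equal `ν · (y - x)`. As `a` and `a'` have opposite signs, one of the two coordinates
  -- is nonnegative, so the two elements cover a neighbourhood of `x`.
  have h3 : a * B.coord p y = a' * B'.coord p' y := by
    rw [B.coord_eq p y x, hx.1, B'.coord_eq p' y x, hx'.1, zero_add, zero_add,
      ← real_inner_smul_left, ← real_inner_smul_left, ← ha, ← ha']
  rcases le_or_gt 0 (B.coord p y) with h | h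
  · exact Set.mem_iUnion.2 ⟨K, h1.2 h⟩
  · refine Set.mem_iUnion.2 ⟨K', h2.2 ?_⟩
    by_contra hn
    have h4 : 0 < B.coord p y * B'.coord p' y := mul_pos_of_neg_of_neg h (not_le.1 hn)
    have h5 : a * B.coord p y * (a * B.coord p y) = a * a' * (B.coord p y * B'.coord p' y) := by
      linear_combination a * B.coord p y * h3
    nlinarith [mul_self_nonneg (a * B.coord p y), mul_pos (neg_pos.2 hopp) h4]

end Triangulation

/-! ### Weak divergences of piecewise polynomial fields -/

lemma frontier_hull_null (K : Finset (Space d)) : volume (frontier (hull K)) = 0 :=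
  (convex_convexHull ℝ _).addHaar_frontier volume

lemma setIntegral_interior_hull (K : Finset (Space d)) (f : Space d → ℝ) :
    ∫ x in interior (hull K), f x = ∫ x in hull K, f x :=
  setIntegral_congr_set (interior_ae_eq_of_null_frontier (frontier_hull_null K))

lemma memLp_indicator_interior_hull {E : Type*} [NormedAddCommGroup E] (K : Finset (Space d))
    {f : Space d → E} (hf : Continuous f) [SecondCountableTopologyEither (Space d) E] :
    MemLp ((interior (hull K)).indicator f) 2 volume := by
  rw [memLp_indicator_iff_restrict isOpen_interior.measurableSet]
  obtain ⟨C, hC⟩ := (isCompact_hull K).exists_bound_of_continuousOn hf.continuousOn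
  have : IsFiniteMeasure (volume.restrict (interior (hull K))) :=
    ⟨by
      rw [Measure.restrict_apply_univ]
      exact (measure_mono interior_subset).trans_lt (isCompact_hull K).measure_lt_top⟩
  refine MemLp.of_bound hf.aestronglyMeasurable C ?_
  filter_upwards [ae_restrict_mem isOpen_interior.measurableSet] with x hx
  exact hC x (interior_subset hx)

namespace Triangulation

variable {Ω : Set (Space d)} (T : Triangulation d Ω)

/-- The elementwise divergence. -/
def divField (τ : T.elements → PolyField d) (x : Space d) : ℝ :=
  ∑ K : T.elements, (interior (hull K.1)).indicator (τ K).div.val x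

lemma setIntegral_sum_indicator (hΩ : interior (closure Ω) = Ω)
    {f : T.elements → Space d → ℝ} (hf : ∀ K, Continuous (f K)) :
    ∫ x in Ω, ∑ K : T.elements, (interior (hull K.1)).indicator (f K) x =
      ∑ K : T.elements, ∫ x in hull K.1, f K x := by
  rw [integral_finsetSum]
  · refine Finset.sum_congr rfl fun K _ => ?_
    rw [setIntegral_indicator isOpen_interior.measurableSet,
      Set.inter_eq_right.2 (T.interior_hull_subset hΩ K), setIntegral_interior_hull]
  · intro K _
    refine Integrable.integrableOn ?_
    refine IntegrableOn.integrable_indicator ?_ isOpen_interior.measurableSet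
    exact ((hf K).continuousOn.integrableOn_compact (isCompact_hull _)).mono_set interior_subset

lemma fderiv_toField (τ : T.elements → PolyField d) (φ : Space d → ℝ) (x : Space d) :
    fderiv ℝ φ x (T.toField τ x) =
      ∑ K : T.elements, (interior (hull K.1)).indicator (fun x => fderiv ℝ φ x ((τ K).val x)) x := by
  rw [toField, map_sum]
  refine Finset.sum_congr rfl fun K _ => ?_
  by_cases hx : x ∈ interior (hull K.1)
  · simp [hx]
  · simp [hx]

lemma divField_mul (τ : T.elements → PolyField d) (φ : Space d → ℝ) (x : Space d) :
    T.divField τ x * φ x =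
      ∑ K : T.elements, (interior (hull K.1)).indicator (fun x => φ x * (τ K).div.val x) x := by
  rw [divField, Finset.sum_mul]
  refine Finset.sum_congr rfl fun K _ => ?_
  by_cases hx : x ∈ interior (hull K.1)
  · simp [hx, mul_comm]
  · simp [hx]

lemma memLp_toField (τ : T.elements → PolyField d) : MemLp (T.toField τ) 2 volume := by
  have h : T.toField τ = ∑ K : T.elements, (interior (hull K.1)).indicator (τ K).val := by
    ext1 x
    simp [toField, Finset.sum_apply]
  rw [h]
  exact memLp_finsetSum' _ fun K _ => memLp_indicator_interior_hull K.1 (τ K).continuous_val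

lemma memLp_divField (τ : T.elements → PolyField d) : MemLp (T.divField τ) 2 volume := by
  have h : T.divField τ = ∑ K : T.elements, (interior (hull K.1)).indicator (τ K).div.val := by
    ext1 x
    simp [divField, Finset.sum_apply]
  rw [h]
  exact memLp_finsetSum' _ fun K _ =>
    memLp_indicator_interior_hull K.1 (Poly.continuous_val (τ K).div)

include T in
lemma isFiniteMeasure_restrict : IsFiniteMeasure (volume.restrict Ω) :=
  ⟨by
    rw [Measure.restrict_apply_univ]
    exact (measure_mono subset_closure).trans_lt T.isCompact_closure.measure_lt_top⟩

/-- The jump of the normal component of a piecewise polynomial field on a facet. -/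
def normalJump (n : Finset (Space d) → Space d) (τ : T.elements → PolyField d)
    (F : Finset (Space d)) : Poly d :=
  ∑ K ∈ T.elementsAt F, MvPolynomial.C (signOf K.1 F (n F)) * (τ K).dot (n F)

lemma val_normalJump (n : Finset (Space d) → Space d) (τ : T.elements → PolyField d)
    (F : Finset (Space d)) (x : Space d) : (T.normalJump n τ F).val x =
      ∑ K ∈ T.elementsAt F, signOf K.1 F (n F) * inner ℝ ((τ K).val x) (n F) := by
  simp [normalJump]

variable {n : Finset (Space d) → Space d} (hn : ∀ F ∈ T.facets, IsUnitNormal F (n F))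

lemma sum_elements_facets [DecidableEq (Space d)]
    (f : T.elements → Finset (Space d) → ℝ) :
    ∑ K : T.elements, ∑ p ∈ K.1, f K (K.1.erase p) =
      ∑ F ∈ T.facets, ∑ K ∈ T.elementsAt F, f K F := by
  rw [Finset.sum_comm' (t' := Finset.univ) (s' := fun K : T.elements =>
    T.facets.filter (fun F => F ⊆ K.1))]
  · refine Finset.sum_congr rfl fun K _ => ?_
    refine Finset.sum_nbij (fun p => K.1.erase p) ?_ ?_ ?_ fun _ _ => rfl
    · intro p hp
      exact Finset.mem_filter.2 ⟨T.erase_mem_facets K hp, Finset.erase_subset _ _⟩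
    · exact Finset.erase_injOn K.1
    · intro F hF
      obtain ⟨h1, h2⟩ := Finset.mem_filter.1 (Finset.mem_coe.1 hF)
      obtain ⟨p, hp, rfl⟩ := T.exists_eq_erase h1 (T.mem_elementsAt.2 h2)
      exact ⟨p, hp, rfl⟩
  · intro F K
    simp [T.mem_elementsAt]

include hn

/-- Elementwise integration by parts, with the boundary terms collected facet by facet. -/
lemma sum_integral_divergence (hd : 1 ≤ d) {φ : T.elements → Space d → ℝ}
    (hφ : ∀ K, ContDiff ℝ 1 (φ K)) (τ : T.elements → PolyField d) :
    ∑ K : T.elements, ∫ x in hull K.1,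
        (fderiv ℝ (φ K) x ((τ K).val x) + φ K x * (τ K).div.val x) =
      ∑ F ∈ T.facets, ∫ x in hull F, ∑ K ∈ T.elementsAt F,
        φ K x * (signOf K.1 F (n F) * inner ℝ ((τ K).val x) (n F))
          ∂(Measure.euclideanHausdorffMeasure (d - 1)) := by
  classical
  have h1 : ∀ K : T.elements, ∫ x in hull K.1,
        (fderiv ℝ (φ K) x ((τ K).val x) + φ K x * (τ K).div.val x) =
      ∑ p ∈ K.1, ∫ x in hull (K.1.erase p),
        φ K x * (signOf K.1 (K.1.erase p) (n (K.1.erase p)) *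
          inner ℝ ((τ K).val x) (n (K.1.erase p)))
            ∂(Measure.euclideanHausdorffMeasure (d - 1)) := fun K =>
    (T.bary K).integral_divergence hd (T.isSimplex K).card_eq
      (ν := fun p => n (K.1.erase p)) (fun p hp => hn _ (T.erase_mem_facets K hp)) (hφ K) (τ K)
  simp_rw [h1]
  rw [T.sum_elements_facets (fun K F => ∫ x in hull F,
    φ K x * (signOf K.1 F (n F) * inner ℝ ((τ K).val x) (n F))
      ∂(Measure.euclideanHausdorffMeasure (d - 1)))]
  refine Finset.sum_congr rfl fun F hF => ?_
  rw [integral_finsetSum]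
  intro K hK
  obtain ⟨p, hp, rfl⟩ := T.exists_eq_erase hF hK
  refine (T.bary K).integrableOn_facet hd (T.isSimplex K).card_eq hp (hn _ hF) ?_
  exact (hφ K).continuous.mul (continuous_const.mul
    ((τ K).continuous_val.inner continuous_const))

lemma integral_fderiv_add_divField (hd : 1 ≤ d) (hΩ : interior (closure Ω) = Ω)
    {φ : Space d → ℝ} (hφ : ContDiff ℝ 1 φ) (τ : T.elements → PolyField d) :
    (∫ x in Ω, fderiv ℝ φ x (T.toField τ x)) + ∫ x in Ω, T.divField τ x * φ x =
      ∑ F ∈ T.facets, ∫ x in hull F, φ x * (T.normalJump n τ F).val x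
          ∂(Measure.euclideanHausdorffMeasure (d - 1)) := by
  have hc1 : ∀ K, Continuous fun x => fderiv ℝ φ x ((τ K).val x) := fun K =>
    (hφ.continuous_fderiv one_ne_zero).clm_apply (τ K).continuous_val
  have hc2 : ∀ K, Continuous fun x => φ x * (τ K).div.val x := fun K =>
    hφ.continuous.mul (Poly.continuous_val _)
  have h := T.sum_integral_divergence hn hd (φ := fun _ => φ) (fun _ => hφ) τ
  simp_rw [← Finset.mul_sum, ← T.val_normalJump] at h
  simp_rw [fderiv_toField, divField_mul]
  rw [← h, T.setIntegral_sum_indicator hΩ hc1, T.setIntegral_sum_indicator hΩ hc2,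
    ← Finset.sum_add_distrib]
  refine Finset.sum_congr rfl fun K _ => ?_
  rw [integral_add ((hc1 K).continuousOn.integrableOn_compact (isCompact_hull _))
    ((hc2 K).continuousOn.integrableOn_compact (isCompact_hull _))]

/-- Fields with matching normal traces lie in `H(div)`. -/
lemma memHDiv_of_normalJump_eq_zero (hd : 1 ≤ d) (hΩ : interior (closure Ω) = Ω)
    (τ : T.elements → PolyField d)
    (h0 : ∀ F ∈ T.facets, F ∉ T.boundaryFacets → ∀ x ∈ hull F, (T.normalJump n τ F).val x = 0) :
    MemHDiv Ω (T.toField τ) := by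
  classical
  refine ⟨(T.memLp_toField τ).restrict Ω, T.divField τ, (T.memLp_divField τ).restrict Ω, ?_⟩
  intro φ hφ _ hφΩ
  have h := T.integral_fderiv_add_divField hn hd hΩ (hφ.of_le (by simp)) τ
  rw [Finset.sum_eq_zero] at h
  · linarith
  · intro F hF
    rw [setIntegral_congr_fun (measurableSet_hull F) (g := fun _ => (0 : ℝ))]
    · simp
    · intro x hx
      by_cases hb : F ∈ T.boundaryFacets
      · have h1 : x ∉ Ω := Set.disjoint_left.1 (T.disjoint_hull_of_mem_boundary hd hΩ hb) hx
        have h2 : φ x = 0 := image_eq_zero_of_notMem_tsupport fun h3 => h1 (hφΩ h3)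
        simp [h2]
      · simp [h0 F hF hb x hx]

/-- The weak divergence of a piecewise polynomial field is its elementwise divergence. -/
lemma ae_eq_divField (hd : 1 ≤ d) (hΩ : interior (closure Ω) = Ω) {τ : T.elements → PolyField d}
    {g : Space d → ℝ} (hg : MemLp g 2 (volume.restrict Ω))
    (hτ : HasWeakDivergence Ω (T.toField τ) g) :
    ∀ᵐ x, x ∈ Ω → g x = T.divField τ x := by
  classical
  have := T.isFiniteMeasure_restrict
  have hgi : Integrable g (volume.restrict Ω) := hg.integrable (by norm_num)
  have hdi : Integrable (T.divField τ) (volume.restrict Ω) :=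
    ((T.memLp_divField τ).restrict Ω).integrable (by norm_num)
  -- Test functions supported off the facets see no boundary terms, and the removed facets are null
  -- sets.
  set U : Set (Space d) := Ω \ ⋃ F ∈ T.facets, hull F with hU
  have hclosed : IsClosed (⋃ F ∈ T.facets, hull F) :=
    T.facets.finite_toSet.isClosed_biUnion fun F _ => (isCompact_hull F).isClosed
  have hUo : IsOpen U := (isOpen_domain hΩ).sdiff hclosed
  have hnull : volume (⋃ F ∈ T.facets, hull F) = 0 := by
    refine (measure_biUnion_null_iff T.facets.countable_toSet).2 fun F hF => ?_
    obtain ⟨-, K, hK⟩ := T.mem_facets.1 hF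
    obtain ⟨p, hp, rfl⟩ := T.exists_eq_erase hF hK
    refine measure_mono_null (fun x hx => ?_) (frontier_hull_null K.1)
    rw [(T.bary K).hull_erase hp] at hx
    refine ⟨subset_closure hx.1, fun hx' => ?_⟩
    rw [(T.bary K).interior_hull] at hx'
    exact (hx' p hp).ne' hx.2
  have h1 : ∀ᵐ x, x ∈ U → g x - T.divField τ x = 0 := by
    refine hUo.ae_eq_zero_of_integral_contDiff_smul_eq_zero
      (f := fun x => g x - T.divField τ x) ?_ fun φ hφ hφc hφU => ?_
    · have h2 : IntegrableOn (fun x => g x - T.divField τ x) Ω := hgi.sub hdi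
      exact (h2.mono_set Set.sdiff_subset).locallyIntegrableOn
    · have hφΩ : tsupport φ ⊆ Ω := hφU.trans Set.sdiff_subset
      have h2 := hτ φ hφ hφc hφΩ
      have h3 := T.integral_fderiv_add_divField hn hd hΩ (hφ.of_le (by simp)) τ
      rw [Finset.sum_eq_zero] at h3
      · obtain ⟨C, hC⟩ := hφc.exists_bound_of_continuous hφ.continuous
        have hint : ∀ f : Space d → ℝ, Integrable f (volume.restrict Ω) →
            Integrable (fun x => f x * φ x) (volume.restrict Ω) := fun f hf =>
          hf.mul_bdd hφ.continuous.aestronglyMeasurable (Filter.Eventually.of_forall hC)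
        rw [← setIntegral_eq_integral_of_forall_compl_eq_zero (s := Ω)]
        · have h4 : ∀ x, φ x • (g x - T.divField τ x) = g x * φ x - T.divField τ x * φ x := by
            intro x; rw [smul_eq_mul]; ring
          simp_rw [h4]
          rw [integral_sub (hint g hgi) (hint _ hdi)]
          linarith
        · intro x hx
          rw [image_eq_zero_of_notMem_tsupport fun h4 => hx (hφΩ h4), zero_smul]
      · intro F hF
        rw [setIntegral_congr_fun (measurableSet_hull F) (g := fun _ => (0 : ℝ))]
        · simp
        · intro x hx
          have h5 : φ x = 0 := image_eq_zero_of_notMem_tsupport fun h4 =>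
            (hφU h4).2 (Set.mem_biUnion hF hx)
          simp [h5]
  filter_upwards [h1, measure_eq_zero_iff_ae_notMem.1 hnull] with x hx hx' hxΩ
  exact sub_eq_zero.1 (hx ⟨hxΩ, hx'⟩)

/-- The normal traces of a field in `H(div)` match. -/
lemma normalJump_eq_zero_of_memHDiv (hd : 1 ≤ d) (hΩ : interior (closure Ω) = Ω)
    {τ : T.elements → PolyField d} (hτ : MemHDiv Ω (T.toField τ)) {F : Finset (Space d)}
    (hF : F ∈ T.facets) (hb : F ∉ T.boundaryFacets) :
    ∀ x ∈ hull F, (T.normalJump n τ F).val x = 0 := by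
  classical
  obtain ⟨-, g, hg, hdiv⟩ := hτ
  have hae := T.ae_eq_divField hn hd hΩ hg hdiv
  have hzero : ∀ φ : Space d → ℝ, ContDiff ℝ ∞ φ → HasCompactSupport φ → tsupport φ ⊆ Ω →
      ∑ F ∈ T.facets, ∫ x in hull F, φ x * (T.normalJump n τ F).val x
          ∂(Measure.euclideanHausdorffMeasure (d - 1)) = 0 := by
    intro φ hφ hφc hφΩ
    rw [← T.integral_fderiv_add_divField hn hd hΩ (hφ.of_le (by simp)) τ, hdiv φ hφ hφc hφΩ,
      neg_add_eq_zero]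
    refine setIntegral_congr_ae (isOpen_domain hΩ).measurableSet ?_
    filter_upwards [hae] with x hx hxΩ
    rw [hx hxΩ]
  obtain ⟨-, K, hK⟩ := T.mem_facets.1 hF
  obtain ⟨p, hp, rfl⟩ := T.exists_eq_erase hF hK
  set B := T.bary K
  have hcard := (T.isSimplex K).card_eq
  set J := T.normalJump n τ (K.1.erase p)
  suffices h : ∀ x ∈ B.facetInterior p, J.val x = 0 by
    have hcl : IsClosed {x | J.val x = 0} := isClosed_eq (Poly.continuous_val J) continuous_const
    intro x hx
    exact (hcl.closure_subset_iff.2 h) (B.hull_erase_subset_closure hd hcard hp hx)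
  intro x hx
  -- A neighbourhood of `x` that meets no other facet. With a bump `η` supported in it, the test
  -- function `η J` isolates this facet and gives `∫ η J² = 0`.
  set U : Set (Space d) := Ω \ ⋃ F ∈ T.facets.erase (K.1.erase p), hull F with hU
  have hclosed : IsClosed (⋃ F ∈ T.facets.erase (K.1.erase p), hull F) :=
    (T.facets.erase (K.1.erase p)).finite_toSet.isClosed_biUnion
      fun F _ => (isCompact_hull F).isClosed
  have hxU : x ∈ U := by
    refine ⟨T.facetInterior_subset_domain hd hΩ B hp hb (hn _ hF) hx, fun h => ?_⟩
    obtain ⟨F', hF', hxF'⟩ := Set.mem_iUnion₂.1 h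
    obtain ⟨hne, hF'f⟩ := Finset.mem_erase.1 hF'
    have h1 := T.erase_subset_of_mem_facetInterior K B (T.facet_mem_faces hd hF'f) hp hx hxF'
    refine hne (Finset.eq_of_subset_of_card_le h1 ?_).symm
    rw [(T.mem_facets.1 hF).1, (T.mem_facets.1 hF'f).1]
  obtain ⟨η, hη1, hη2, hη3, hη4, hη5⟩ := exists_contDiff_tsupport_subset (n := ⊤)
    (((isOpen_domain hΩ).sdiff hclosed).mem_nhds hxU)
  have h1 := hzero (fun y => η y * J.val y) (hη3.mul (Poly.contDiff_val J)) (hη2.mul_right)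
    ((closure_mono (Function.support_mul_subset_left _ _)).trans (hη1.trans Set.sdiff_subset))
  rw [Finset.sum_eq_single_of_mem _ hF] at h1
  · have hnn : ∀ y, 0 ≤ η y * J.val y * J.val y := fun y => by
      rw [mul_assoc]
      exact mul_nonneg (hη4 ⟨y, rfl⟩).1 (mul_self_nonneg _)
    have h2 := B.eqOn_zero_of_integral_facet_eq_zero hd hcard hp (hn _ hF)
      (f := fun y => η y * J.val y * J.val y)
      ((hη3.continuous.mul (Poly.continuous_val J)).mul (Poly.continuous_val J))
      (fun y _ => hnn y) h1 x (B.facetInterior_subset hp hx)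
    simpa [hη5] using h2
  · intro F' hF' hne
    rw [setIntegral_congr_fun (measurableSet_hull F') (g := fun _ => (0 : ℝ))]
    · simp
    · intro y hy
      have h3 : η y = 0 := image_eq_zero_of_notMem_tsupport fun h4 =>
        (hη1 h4).2 (Set.mem_biUnion (Finset.mem_erase.2 ⟨hne, hF'⟩) hy)
      simp [h3]

end Triangulation

/-! ### The facet inner product -/

lemma maxEigenvalue_pos (hd : 1 ≤ d) {M : Matrix (Fin d) (Fin d) ℝ} (hM : M.PosDef) :
    0 < maxEigenvalue M := by
  unfold maxEigenvalue
  rw [hM.isHermitian.spectrum_real_eq_range_eigenvalues]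
  exact (hM.eigenvalues_pos ⟨0, hd⟩).trans_le
    (le_csSup (Set.finite_range _).bddAbove ⟨⟨0, hd⟩, rfl⟩)

namespace Triangulation

variable {Ω : Set (Space d)} (T : Triangulation d Ω)

/-- Here `d ≥ 2` is essential: for `d = 1` a facet is a point and has diameter `0`. -/
lemma facetSize_pos (hd : 2 ≤ d) {F : Finset (Space d)} (hF : F ∈ T.facets) : 0 < facetSize F := by
  have hc := (T.mem_facets.1 hF).1
  obtain ⟨x, hx, y, hy, hxy⟩ := Finset.one_lt_card.1 (by omega : 1 < F.card)
  exact (dist_pos.2 hxy).trans_le (Metric.dist_le_diam_of_mem (isCompact_hull F).isBounded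
    (subset_convexHull ℝ _ hx) (subset_convexHull ℝ _ hy))

lemma facetCoeff_pos (hd : 1 ≤ d) {A : T.elements → Matrix (Fin d) (Fin d) ℝ}
    (hA : ∀ K, (A K).PosDef) {F : Finset (Space d)} (hF : F ∈ T.facets) :
    0 < T.facetCoeff A F := by
  obtain ⟨-, K, hK⟩ := T.mem_facets.1 hF
  have : Nonempty (T.elementsAt F) := ⟨⟨K, hK⟩⟩
  obtain ⟨L, hL⟩ := exists_eq_ciInf_of_finite (f := fun K : T.elementsAt F => maxEigenvalue (A K.1))
  unfold facetCoeff
  rw [← hL]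
  exact maxEigenvalue_pos hd (hA _)

lemma mem_facetsOutside {EN : Finset (Finset (Space d))} {F : Finset (Space d)} :
    F ∈ T.facetsOutside EN ↔ F ∈ T.facets ∧ F ∉ EN := by
  simp [facetsOutside]

lemma totalDegree_jump_le {s : ℕ} {w : T.elements → Poly d} (hw : w ∈ T.DG s)
    (n : Finset (Space d) → Space d) (F : Finset (Space d)) :
    ∃ g : Poly d, g.totalDegree ≤ s ∧ ∀ x, g.val x = T.jump n w F x := by
  refine ⟨∑ K ∈ T.elementsAt F, MvPolynomial.C (signOf K.1 F (n F)) * w K, ?_, fun x => ?_⟩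
  · refine (MvPolynomial.totalDegree_finsetSum _ _).trans (Finset.sup_le fun K _ => ?_)
    refine (MvPolynomial.totalDegree_mul _ _).trans ?_
    rw [MvPolynomial.totalDegree_C, zero_add]
    exact hw K
  · simp [jump]

/-- By conformity the interiors of distinct elements are disjoint. -/
lemma divField_eq_of_mem_interior (τ : T.elements → PolyField d) {K : T.elements} {x : Space d}
    (hx : x ∈ interior (hull K.1)) : T.divField τ x = (τ K).div.val x := by
  classical
  rw [divField, Finset.sum_eq_single_of_mem K (Finset.mem_univ K), Set.indicator_of_mem hx]
  intro L _ hne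
  refine Set.indicator_of_notMem (fun hxL => ?_) _
  obtain ⟨q, hq, hqL⟩ := Finset.not_subset.1 fun h : K.1 ⊆ L.1 => hne
    (Subtype.ext (Finset.eq_of_subset_of_card_le h (by
      rw [(T.isSimplex K).card_eq, (T.isSimplex L).card_eq])).symm)
  have h1 := T.coord_eq_zero_of_mem_face K (T.bary K) (T.mem_elements.1 L.2).1
    (interior_subset hx) (interior_subset hxL) hq hqL
  rw [(T.bary K).interior_hull] at hx
  exact (hx q hq).ne' h1

variable {n : Finset (Space d) → Space d} (hn : ∀ F ∈ T.facets, IsUnitNormal F (n F))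
  {EN : Finset (Finset (Space d))} {s : ℕ} {A : T.elements → Matrix (Fin d) (Fin d) ℝ}

include hn

/-- At an interior facet the two signs are opposite and nonzero, so a vanishing jump means equal
traces. -/
lemma inner_normal_eq (hd : 1 ≤ d) (hΩ : interior (closure Ω) = Ω) {τ : T.elements → PolyField d}
    (hτ : MemHDiv Ω (T.toField τ)) {F : Finset (Space d)} (hF : F ∈ T.facets) {K K' : T.elements}
    (hK : K ∈ T.elementsAt F) (hK' : K' ∈ T.elementsAt F) {x : Space d} (hx : x ∈ hull F) :
    inner ℝ ((τ K).val x) (n F) = inner ℝ ((τ K').val x) (n F) := by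
  classical
  by_cases hb : F ∈ T.boundaryFacets
  · simp only [boundaryFacets, Finset.mem_filter] at hb
    obtain ⟨L, hL⟩ := Finset.card_eq_one.1 hb.2
    rw [hL, Finset.mem_singleton] at hK hK'
    rw [hK, hK']
  · obtain ⟨L, L', hne, hLL', hsign⟩ := T.exists_pair_of_notMem_boundary hd hF hb (hn F hF)
    have h := T.normalJump_eq_zero_of_memHDiv hn hd hΩ hτ hF hb x hx
    rw [val_normalJump, hLL', Finset.sum_pair hne] at h
    have hs' : signOf L'.1 F (n F) = - signOf L.1 F (n F) := by linarith
    have hs0 : signOf L.1 F (n F) ≠ 0 := by unfold signOf; split_ifs <;> norm_num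
    rw [hs', neg_mul, ← sub_eq_add_neg, ← mul_sub, mul_eq_zero, sub_eq_zero] at h
    have h1 := h.resolve_left hs0
    rw [hLL'] at hK hK'
    simp only [Finset.mem_insert, Finset.mem_singleton] at hK hK'
    rcases hK with rfl | rfl <;> rcases hK' with rfl | rfl <;> simp [h1]

lemma normalTrace_eq (hd : 1 ≤ d) (hΩ : interior (closure Ω) = Ω) {τ : T.elements → PolyField d}
    (hτ : MemHDiv Ω (T.toField τ)) {F : Finset (Space d)} (hF : F ∈ T.facets) {K : T.elements}
    (hK : K ∈ T.elementsAt F) {x : Space d} (hx : x ∈ hull F) :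
    T.normalTrace n τ F x = inner ℝ ((τ K).val x) (n F) := by
  have hc : ((T.elementsAt F).card : ℝ) ≠ 0 := by
    exact_mod_cast (Finset.card_pos.2 ⟨K, hK⟩).ne'
  rw [normalTrace, Finset.sum_congr rfl fun L hL => T.inner_normal_eq hn hd hΩ hτ hF hL hK hx,
    Finset.sum_const, nsmul_eq_mul, ← mul_assoc, inv_mul_cancel₀ hc, one_mul]

/-- Elements of the constrained Raviart-Thomas space are determined by their normal traces. -/
lemma eq_of_normal_eq (hd : 1 ≤ d) {σ τ : T.elements → PolyField d}
    (hσ : σ ∈ T.RTring EN n s) (hτ : τ ∈ T.RTring EN n s)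
    (h : ∀ F ∈ T.facetsOutside EN, ∀ K ∈ T.elementsAt F, ∀ x ∈ hull F,
      inner ℝ ((σ K).val x) (n F) = inner ℝ ((τ K).val x) (n F)) : σ = τ := by
  classical
  ext1 K
  rw [← sub_eq_zero]
  refine (T.bary K).localRT_eq_zero hd (T.isSimplex K).card_eq (ν := fun p => n (K.1.erase p))
    (fun p hp => hn _ (T.erase_mem_facets K hp)) (localRT_sub (hσ.1.1 K) (hτ.1.1 K))
    (fun p hp x hx => ?_) fun ψ hψ => ?_
  · have hK := T.mem_elementsAt_erase K p
    rw [PolyField.val_sub, inner_sub_left, sub_eq_zero]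
    by_cases hEN : K.1.erase p ∈ EN
    · rw [hσ.2.2 _ hEN K hK x hx, hτ.2.2 _ hEN K hK x hx]
    · exact h _ (T.mem_facetsOutside.2 ⟨T.erase_mem_facets K hp, hEN⟩) K hK x hx
  · rw [← PolyField.pairing_apply, map_sub, LinearMap.sub_apply, PolyField.pairing_apply,
      PolyField.pairing_apply, hσ.2.1 K ψ hψ, hτ.2.1 K ψ hψ, sub_zero]

/-- All weights are positive, so a zero value forces zero traces outside `EN`. On `EN` they vanish
by definition, and local unisolvence applies. -/
lemma facetInner_self_pos (hd : 2 ≤ d) (hΩ : interior (closure Ω) = Ω)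
    (hA : ∀ K, (A K).PosDef) {σ : T.elements → PolyField d} (hσ : σ ∈ T.RTring EN n s)
    (h0 : σ ≠ 0) : 0 < T.facetInner A EN n σ σ := by
  classical
  have hd1 : 1 ≤ d := by omega
  have hnn : ∀ F ∈ T.facetsOutside EN, 0 ≤ facetSize F * (T.facetCoeff A F)⁻¹ *
      ∫ x in hull F, T.normalTrace n σ F x * T.normalTrace n σ F x
        ∂(Measure.euclideanHausdorffMeasure (d - 1)) := by
    intro F hF
    have hF' := (T.mem_facetsOutside.1 hF).1
    exact mul_nonneg (mul_nonneg (T.facetSize_pos hd hF').le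
      (inv_nonneg.2 (T.facetCoeff_pos hd1 hA hF').le))
      (integral_nonneg fun x => mul_self_nonneg _)
  refine lt_of_le_of_ne (Finset.sum_nonneg hnn) fun h => h0 ?_
  rw [eq_comm, facetInner, Finset.sum_eq_zero_iff_of_nonneg hnn] at h
  have htr : ∀ F ∈ T.facetsOutside EN, ∀ K ∈ T.elementsAt F, ∀ x ∈ hull F,
      inner ℝ ((σ K).val x) (n F) = 0 := by
    intro F hF K hK
    have hF' := (T.mem_facetsOutside.1 hF).1
    have h1 := (mul_eq_zero.1 (h F hF)).resolve_left (mul_pos (T.facetSize_pos hd hF')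
      (inv_pos.2 (T.facetCoeff_pos hd1 hA hF'))).ne'
    rw [setIntegral_congr_fun (measurableSet_hull F)
      (g := fun x => inner ℝ ((σ K).val x) (n F) * inner ℝ ((σ K).val x) (n F))
      fun x hx => by simp only [T.normalTrace_eq hn hd1 hΩ hσ.1.2 hF' hK hx]] at h1
    obtain ⟨p, hp, rfl⟩ := T.exists_eq_erase hF' hK
    have hc : Continuous fun x => inner ℝ ((σ K).val x) (n (K.1.erase p)) :=
      (σ K).continuous_val.inner continuous_const
    intro x hx
    exact mul_self_eq_zero.1 ((T.bary K).eqOn_zero_of_integral_facet_eq_zero hd1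
      (T.isSimplex K).card_eq hp (hn _ hF') (hc.mul hc) (fun x _ => mul_self_nonneg _) h1 x hx)
  ext1 K
  refine (T.bary K).localRT_eq_zero hd1 (T.isSimplex K).card_eq (ν := fun p => n (K.1.erase p))
    (fun p hp => hn _ (T.erase_mem_facets K hp)) (hσ.1.1 K) (fun p hp x hx => ?_) (hσ.2.1 K)
  have hK := T.mem_elementsAt_erase K p
  by_cases hEN : K.1.erase p ∈ EN
  · exact hσ.2.2 _ hEN K hK x hx
  · exact htr _ (T.mem_facetsOutside.2 ⟨T.erase_mem_facets K hp, hEN⟩) K hK x hx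

/-- Prescribed polynomial normal traces are attained in the constrained Raviart-Thomas space. -/
lemma exists_mem_RTring (hd : 1 ≤ d) (hΩ : interior (closure Ω) = Ω)
    (hEN : EN ⊆ T.boundaryFacets) (g : Finset (Space d) → Poly d)
    (hg : ∀ F, (g F).totalDegree ≤ s) :
    ∃ σ ∈ T.RTring EN n s, ∀ F ∈ T.facetsOutside EN, ∀ K ∈ T.elementsAt F, ∀ x ∈ hull F,
      inner ℝ ((σ K).val x) (n F) = (g F).val x := by
  classical
  have hex : ∀ K : T.elements, ∃ q ∈ localRT d s,
      (∀ p ∈ K.1, ∀ x ∈ hull (K.1.erase p), inner ℝ (q.val x) (n (K.1.erase p)) =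
        Poly.val (if K.1.erase p ∈ EN then 0 else g (K.1.erase p)) x) ∧
      ∀ ψ : PolyField d, (∀ i, (ψ i).totalDegree < s) →
        ∫ x in hull K.1, inner ℝ (q.val x) (ψ.val x) = 0 := fun K =>
    (T.bary K).exists_localRT hd (T.isSimplex K).card_eq (ν := fun p => n (K.1.erase p))
      (fun p hp => hn _ (T.erase_mem_facets K hp))
      (fun p => if K.1.erase p ∈ EN then 0 else g (K.1.erase p))
      fun p _ => by
        split_ifs
        · simp
        · exact hg _
  choose σ hσ htr hmom using hex
  have htr' : ∀ F ∈ T.facets, ∀ K ∈ T.elementsAt F, ∀ x ∈ hull F,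
      inner ℝ ((σ K).val x) (n F) = Poly.val (if F ∈ EN then 0 else g F) x := by
    intro F hF K hK
    obtain ⟨p, hp, rfl⟩ := T.exists_eq_erase hF hK
    exact htr K p hp
  refine ⟨σ, ⟨⟨hσ, ?_⟩, hmom, fun F hF K hK x hx => ?_⟩, fun F hF K hK x hx => ?_⟩
  · refine T.memHDiv_of_normalJump_eq_zero hn hd hΩ σ fun F hF hb x hx => ?_
    -- Both neighbours have the same trace along the same normal `n F`, and their signs sum to zero.
    obtain ⟨L, L', hne, hLL', hsign⟩ := T.exists_pair_of_notMem_boundary hd hF hb (hn F hF)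
    rw [val_normalJump, Finset.sum_congr rfl fun K hK => by rw [htr' F hF K hK x hx],
      ← Finset.sum_mul, hLL', Finset.sum_pair hne, hsign, zero_mul]
  · have hF' : F ∈ T.facets := by
      have := hEN hF
      simp only [boundaryFacets, Finset.mem_filter] at this
      exact this.1
    rw [htr' F hF' K hK x hx, if_pos hF, Poly.val_zero]
  · obtain ⟨hF', hFN⟩ := T.mem_facetsOutside.1 hF
    rw [htr' F hF' K hK x hx, if_neg hFN]

/-- A field whose normal traces are the scaled jumps of a piecewise polynomial is orthogonal to the
divergence-free fields. -/
lemma facetInner_eq_zero (hd : 2 ≤ d) (hΩ : interior (closure Ω) = Ω)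
    (hA : ∀ K, (A K).PosDef) {w : T.elements → Poly d} (hw : w ∈ T.DG s)
    {σ τ : T.elements → PolyField d} (hσ : σ ∈ T.RTring EN n s)
    (htr : ∀ F ∈ T.facetsOutside EN, ∀ K ∈ T.elementsAt F, ∀ x ∈ hull F,
      inner ℝ ((σ K).val x) (n F) = T.facetCoeff A F * (facetSize F)⁻¹ * T.jump n w F x)
    (hτ : τ ∈ T.RTringDivFree EN n s) : T.facetInner A EN n σ τ = 0 := by
  classical
  have hd1 : 1 ≤ d := by omega
  -- The weak divergence is the elementwise one almost everywhere, so each polynomial divergence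
  -- vanishes on an open set.
  have hdiv : ∀ K, (τ K).div = 0 := by
    intro K
    have h1 := T.ae_eq_divField hn hd1 hΩ (MemLp.zero' (p := 2) (μ := volume.restrict Ω)) hτ.2
    refine Poly.eq_zero_of_val_eq_zero (S := interior (hull K.1))
      (by rw [interior_interior]; exact (T.bary K).interior_nonempty) ?_
    refine Measure.eqOn_open_of_ae_eq (μ := volume) (g := fun _ => (0 : ℝ)) ?_ isOpen_interior
      (Poly.continuous_val _).continuousOn continuousOn_const
    filter_upwards [ae_restrict_of_ae h1, ae_restrict_mem isOpen_interior.measurableSet] with x h2 hx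
    rw [← T.divField_eq_of_mem_interior τ hx, ← h2 (T.interior_hull_subset hΩ K hx)]
  -- The test function `w` is discontinuous across facets, and the boundary terms collect into its
  -- jumps.
  have hibp := T.sum_integral_divergence hn hd1 (φ := fun K => (w K).val)
    (fun K => Poly.contDiff_val (w K)) τ
  rw [Finset.sum_eq_zero fun K _ => by
    simpa [hdiv K] using integral_fderiv_eq_zero_of_moments (hτ.1.2.1 K) (hw K)] at hibp
  rw [hibp, facetInner]
  have hsub : T.facetsOutside EN ⊆ T.facets := fun F hF => (T.mem_facetsOutside.1 hF).1
  rw [← Finset.sum_subset hsub]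
  · refine Finset.sum_congr rfl fun F hF => ?_
    have hF' := hsub hF
    rw [← integral_const_mul]
    refine setIntegral_congr_fun (measurableSet_hull F) fun x hx => ?_
    obtain ⟨-, K, hK⟩ := T.mem_facets.1 hF'
    have hs := (T.facetSize_pos hd hF').ne'
    have hc := (T.facetCoeff_pos hd1 hA hF').ne'
    rw [T.normalTrace_eq hn hd1 hΩ hσ.1.2 hF' hK hx, htr F hF K hK x hx, jump]
    have h2 : ∀ L ∈ T.elementsAt F, (w L).val x * (signOf L.1 F (n F) *
        inner ℝ ((τ L).val x) (n F)) =
        signOf L.1 F (n F) * (w L).val x * T.normalTrace n τ F x := fun L hL => by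
      rw [T.normalTrace_eq hn hd1 hΩ hτ.1.1.2 hF' hL hx]; ring
    rw [Finset.sum_congr rfl h2, ← Finset.sum_mul]
    field_simp
  · intro F hF hFN
    have hFN' : F ∈ EN := by
      by_contra h
      exact hFN (T.mem_facetsOutside.2 ⟨hF, h⟩)
    rw [setIntegral_congr_fun (measurableSet_hull F) (g := fun _ => (0 : ℝ))]
    · simp
    · intro x hx
      exact Finset.sum_eq_zero fun K hK => by rw [hτ.1.2.2 F hFN' K hK x hx]; simp

end Triangulation

end EARM

end

/-! ### The main theorem -/

theorem mainTheorem2 {d : ℕ} (hd : 2 ≤ d) {Ω : Set (EARM.Space d)}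
    (hΩ : interior (closure Ω) = Ω) (T : EARM.Triangulation d Ω)
    (A : T.elements → Matrix (Fin d) (Fin d) ℝ) (hA : ∀ K, (A K).PosDef)
    (EN : Finset (Finset (EARM.Space d))) (hEN : EN ⊆ T.boundaryFacets)
    (n : Finset (EARM.Space d) → EARM.Space d) (hn : T.IsNormalField n) (s : ℕ) :
    (∀ σ ∈ T.RTring EN n s, σ ≠ 0 → 0 < T.facetInner A EN n σ σ) ∧
    ∃ S : T.DG s → T.RTring EN n s,
      (∀ (w : T.DG s) (σ : T.RTring EN n s), σ = S w ↔
        ∀ F ∈ T.facetsOutside EN, ∀ K ∈ T.elementsAt F, ∀ x ∈ EARM.hull F,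
          inner ℝ ((σ.1 K).val x) (n F) =
            T.facetCoeff A F * (EARM.Triangulation.facetSize F)⁻¹ * T.jump n w.1 F x) ∧
      {σ : T.elements → EARM.PolyField d | ∃ w : T.DG s, σ = S w} ⊆
        T.RTringDivFreePerp A EN n s := by
  have hd1 : 1 ≤ d := by omega
  have hex : ∀ w : T.DG s, ∃ σ : T.RTring EN n s,
      ∀ F ∈ T.facetsOutside EN, ∀ K ∈ T.elementsAt F, ∀ x ∈ EARM.hull F,
        inner ℝ ((σ.1 K).val x) (n F) =
          T.facetCoeff A F * (EARM.Triangulation.facetSize F)⁻¹ * T.jump n w.1 F x := by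
    intro w
    choose g hg hgx using T.totalDegree_jump_le w.2 n
    obtain ⟨σ, hσ, htr⟩ := T.exists_mem_RTring (s := s) hn.1 hd1 hΩ hEN
      (fun F => MvPolynomial.C (T.facetCoeff A F * (EARM.Triangulation.facetSize F)⁻¹) * g F)
      fun F => by
        refine (MvPolynomial.totalDegree_mul _ _).trans ?_
        rw [MvPolynomial.totalDegree_C, zero_add]
        exact hg F
    refine ⟨⟨σ, hσ⟩, fun F hF K hK x hx => ?_⟩
    rw [htr F hF K hK x hx, EARM.Poly.val_mul, EARM.Poly.val_C, hgx]
  choose S hS using hex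
  refine ⟨fun σ hσ h0 => T.facetInner_self_pos hn.1 hd hΩ hA hσ h0, S,
    fun w σ => ⟨?_, fun h => ?_⟩, ?_⟩
  · rintro rfl
    exact hS w
  · refine Subtype.ext (T.eq_of_normal_eq hn.1 hd1 σ.2 (S w).2 fun F hF K hK x hx => ?_)
    rw [h F hF K hK x hx, hS w F hF K hK x hx]
  · rintro _ ⟨w, rfl⟩
    exact ⟨(S w).2, fun τ hτ => T.facetInner_eq_zero hn.1 hd hΩ hA w.2 (S w).2 (hS w) hτ⟩
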